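/- Let $(\Lambda,\mathcal E)$ be a finite (simple, undirected) graph, $S\in\frac12\mathbb N=\{0,\frac12,1,\dots\}$, $u\in[0,1]$, $\beta\ge 0$ and $h=(h_x)_{x\in\Lambda}\in\mathbb R^\Lambda$. On $\mathcal H_\Lambda=\bigotimes_{x\in\Lambda}\mathbb C^{2S+1}$, with the basis $|\sigma\rangle$, $\sigma\in\{-S,-S+1,\dots,S\}^\Lambda$, let $S^3_x|\sigma\rangle=\sigma_x|\sigma\rangle$, and for $\{x,y\}\in\mathcal E$ let $T_{xy}$ and $Q_{xy}$ be the operators acting on the factors $x,y$ by $$T_{xy}|a,b\rangle=|b,a\rangle,\qquad \langle a,b|Q_{xy}|c,d\rangle=\delta_{a,b}\,\delta_{c,d}.$$ Let $$H^{(u)}_{\Lambda,h}=-\sum_{\{x,y\}\in\mathcal E}\bigl(u\,T_{xy}+(1-u)\,Q_{xy}-1\bigr)-\sum_{x\in\Lambda}h_xS^3_x,\qquad Z^{(u)}(\beta,\Lambda,h)=\operatorname{Tr}_{\mathcal H_\Lambda} e^{-\beta H^{(u)}_{\Lambda,h}}.$$ Let $\rho(d\omega)$ be the law of the Poisson point measure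 on $\mathcal E\times\{\text{cross},\text{double bar}\}\times[0,\beta]$ under which, independently on each edge, crosses occur with intensity $u\,dt$ and double bars with intensity $(1-u)\,dt$. For a realization $\omega$, let $\mathcal L(\omega)$ be the set of loops: the classes of points $(x,t)\in\Lambda\times[0,\beta]$ at which no event takes place, under the equivalence relation generated by the following connections. Points $(x,s)$ and $(x,t)$ are connected if no event at an edge containing $x$ has its time in between; $(x,0)$ is connected to $(x,\beta)$; a cross at $\{x,y\}\times\tau$ connects the line at $x$ just below $\tau$ to the line at $y$ just above $\tau$, and the line at $y$ just below $\tau$ to the line at $x$ just above $\tau$; a double bar at $\{x,y\}\times\tau$ connects the lines at $x$ and $y$ just below $\tau$, and connects the lines at $x$ and $y$ just above $\tau$. Let $\ell_x(\gamma)$ be the total length of the vertical elements of the loop $\gamma$ at the site $x$, and let $$w(\gamma)=\sum_{a=-S}^{S}\exp\Bigl\{a\sum_{x\in\Lambda}h_x\,\ell_x(\gamma)\Bigr\}.$$ Then $\omega\mapsto\prod_{\gamma\in\mathcal L(\omega)}w(\gamma)$ is $\rho$-integrable and $$Z^{(u)}(\beta,\Lambda,h)=\int\rho(d\omega)\prod_{\gamma\in\mathcal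 L(\omega)}w(\gamma).$$ In particular, for $h\equiv0$, $$Z^{(u)}(\beta,\Lambda,0)=\int(2S+1)^{|\mathcal L(\omega)|}\,\rho(d\omega).$$ -/

import Mathlib

open MeasureTheory
open scoped ENNReal Nat

namespace RandomLoop

noncomputable section

/-! ### Quantum spin system

The spin is `S = N / 2` with `N : ℕ`. The `2S+1` values `-S, -S+1, …, S` are indexed by
`Fin (N + 1)`, and `⨂_{x ∈ V} ℂ^{2S+1}` is described through its basis of classical
configurations `V → Fin (N + 1)`: operators are matrices in that basis. -/

/-- The `i`-th spin value, `-S + i`. -/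
def spin (N : ℕ) (i : Fin (N + 1)) : ℝ := (i : ℝ) - (N : ℝ) / 2

/-- Operators on `ℂ^{2S+1} ⊗ ℂ^{2S+1}`; the index `(a, b)` stands for `|a, b⟩`. -/
abbrev TwoSiteOp (N : ℕ) : Type :=
  Matrix (Fin (N + 1) × Fin (N + 1)) (Fin (N + 1) × Fin (N + 1)) ℂ

/-- Operators on `⨂_{x ∈ V} ℂ^{2S+1}`. -/
abbrev Op (V : Type*) (N : ℕ) : Type _ :=
  Matrix (V → Fin (N + 1)) (V → Fin (N + 1)) ℂ

/-- The transposition `T |a, b⟩ = |b, a⟩`. -/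
def T (N : ℕ) : TwoSiteOp N :=
  Matrix.of fun p q => if p.1 = q.2 ∧ p.2 = q.1 then 1 else 0

/-- The operator `Q` with `⟨a, b| Q |c, d⟩ = δ_{a,b} δ_{c,d}`. -/
def Q (N : ℕ) : TwoSiteOp N :=
  Matrix.of fun p q => if p.1 = p.2 ∧ q.1 = q.2 then 1 else 0

/-- The two-site interaction `u T + (1 - u) Q - 1`. -/
def bond (N : ℕ) (u : ℝ) : TwoSiteOp N :=
  (u : ℂ) • T N + ((1 - u : ℝ) : ℂ) • Q N - 1

variable {V : Type*} [Fintype V] [DecidableEq V]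

/-- The extension `A_{xy} ⊗ Id_{V ∖ {x, y}}` of a two-site operator. -/
def extendOp {N : ℕ} (A : TwoSiteOp N) (x y : V) : Op V N :=
  Matrix.of fun σ τ =>
    if ∀ z, z ≠ x → z ≠ y → σ z = τ z then A (σ x, σ y) (τ x, τ y) else 0

theorem bond_swap (N : ℕ) (u : ℝ) (a b c d : Fin (N + 1)) :
    bond N u (a, b) (c, d) = bond N u (b, a) (d, c) := by
  have h1 : (a = d ∧ b = c) ↔ (b = c ∧ a = d) := And.comm
  have h2 : (a = b ∧ c = d) ↔ (b = a ∧ d = c) := by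
    rw [eq_comm, @eq_comm _ c d]
  have h3 : (a = c ∧ b = d) ↔ (b = d ∧ a = c) := And.comm
  simp only [bond, T, Q, Matrix.sub_apply, Matrix.add_apply, Matrix.smul_apply,
    Matrix.of_apply, Matrix.one_apply, Prod.mk.injEq, h1, h2, h3]

theorem extend_bond_symm (N : ℕ) (u : ℝ) (x y : V) :
    extendOp (bond N u) x y = extendOp (bond N u) y x := by
  ext σ τ
  have h : (∀ z, z ≠ x → z ≠ y → σ z = τ z) ↔ (∀ z, z ≠ y → z ≠ x → σ z = τ z) :=
    forall_congr' fun _ => forall_comm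
  simp only [extendOp, Matrix.of_apply, h, bond_swap N u (σ x) (σ y)]

/-- The interaction `u T_{xy} + (1 - u) Q_{xy} - 1` of the unordered pair `{x, y}`. -/
def edgeBond (N : ℕ) (u : ℝ) : Sym2 V → Op V N :=
  Sym2.lift ⟨fun x y => extendOp (bond N u) x y, extend_bond_symm N u⟩

/-- The third spin operator at `x`: `S³_x |σ⟩ = σ_x |σ⟩`. -/
def spinZ (N : ℕ) (x : V) : Op V N :=
  Matrix.diagonal fun σ => ((spin N (σ x) : ℝ) : ℂ)

variable (G : SimpleGraph V) [DecidableRel G.Adj]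

/-- `H^{(u)} = - ∑_{{x,y} ∈ E} (u T_{xy} + (1 - u) Q_{xy} - 1) - ∑_x h_x S³_x`. -/
def hamiltonian (N : ℕ) (u : ℝ) (h : V → ℝ) : Op V N :=
  -(∑ e ∈ G.edgeFinset, edgeBond N u e) - ∑ x, (h x : ℂ) • spinZ N x

/-- `Z^{(u)}(β, Λ, h) = Tr e^{-β H^{(u)}}`. -/
def partitionFunction (N : ℕ) (u β : ℝ) (h : V → ℝ) : ℂ :=
  (NormedSpace.exp (-((β : ℂ) • hamiltonian G N u h))).trace

end

/-! ### Poisson point measures -/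

noncomputable section

variable {X : Type*}

/-- The configuration `{x₁, …, xₙ}`, with multiplicities, of an `n`-tuple of points. -/
def toConfig (n : ℕ) (x : Fin n → X) : Multiset X := Finset.univ.val.map x

/-- Finite configurations of points form the disjoint union over `n` of the quotients of `X^n`
by permutations; they carry the quotient σ-algebra. -/
instance configMeasurableSpace [MeasurableSpace X] : MeasurableSpace (Multiset X) :=
  ⨅ n : ℕ, MeasurableSpace.map (toConfig n) inferInstance

/-- The law of the Poisson point measure with finite intensity measure `μ`:
`∫ F dρ = e^{-μ(X)} ∑ₙ (1 / n!) ∫ F({x₁, …, xₙ}) μ(dx₁) ⋯ μ(dxₙ)`. -/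
def poissonLaw [MeasurableSpace X] (μ : Measure X) : Measure (Multiset X) :=
  Measure.sum fun n : ℕ =>
    (ENNReal.ofReal (Real.exp (-μ.real Set.univ)) / (n ! : ℝ≥0∞)) •
      (Measure.pi fun _ : Fin n => μ).map (toConfig n)

end

/-! ### Crosses and double bars -/

/-- The two kinds of events. -/
inductive Kind where
  | cross
  | doubleBar

/-- An edge together with the kind of the event that occurs there. -/
structure Mark {V : Type*} (G : SimpleGraph V) where
  edge : G.edgeSet
  kind : Kind

instance {V : Type*} (G : SimpleGraph V) : MeasurableSpace (Mark G) := ⊤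

/-- A cross or double bar at an edge, and its time. -/
abbrev Event {V : Type*} (G : SimpleGraph V) : Type _ := Mark G × ℝ

noncomputable section

variable {V : Type*} (G : SimpleGraph V)

/-- On each edge and over `[0, β]`, crosses have intensity `u` and double bars have intensity
`1 - u` (with respect to the Lebesgue measure). -/
def intensity [Fintype G.edgeSet] (u β : ℝ) : Measure (Event G) :=
  ∑ e : G.edgeSet,
    (ENNReal.ofReal u • Measure.dirac (⟨e, Kind.cross⟩ : Mark G) +
      ENNReal.ofReal (1 - u) • Measure.dirac (⟨e, Kind.doubleBar⟩ : Mark G)).prod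
        (volume.restrict (Set.Icc 0 β))

/-- The measure `ρ(dω)`. -/
def rho [Fintype G.edgeSet] (u β : ℝ) : Measure (Multiset (Event G)) :=
  poissonLaw (intensity G u β)

/-! ### Loops -/

variable {G}

/-- No event of `ω` at an edge containing `x` has its time in `I`. -/
def IsFree (ω : Multiset (Event G)) (x : V) (I : Set ℝ) : Prop :=
  ∀ e ∈ ω, x ∈ (e.1.edge : Sym2 V) → e.2 ∉ I

/-- The points of `V × [0, β]` where no event takes place. -/
def RegularPoint (β : ℝ) (ω : Multiset (Event G)) : Type _ :=
  {p : V × ℝ // p.2 ∈ Set.Icc 0 β ∧ IsFree ω p.1 {p.2}}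

/-- The elementary connections: vertical lines without events, periodicity in time, and the
connections through an event at `{x, y} × τ`. A cross connects the line at `x` just below `τ` to
the line at `y` just above `τ`; since `s(x, y) = s(y, x)`, it also connects `y` just below `τ` to
`x` just above. A double bar connects the lines at `x` and `y` just below `τ`, and it connects
the lines at `x` and `y` just above `τ`. -/
inductive Connected (β : ℝ) (ω : Multiset (Event G)) : V × ℝ → V × ℝ → Prop where
  | vertical (x : V) (s t : ℝ) (hst : s ≤ t) (hf : IsFree ω x (Set.Icc s t)) :
      Connected β ω (x, s) (x, t)
  | periodic (x : V) : Connected β ω (x, 0) (x, β)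
  | cross (x y : V) (hxy : s(x, y) ∈ G.edgeSet) (τ s t : ℝ)
      (hω : ((⟨⟨s(x, y), hxy⟩, Kind.cross⟩, τ) : Event G) ∈ ω)
      (hs : s < τ) (ht : τ < t)
      (hx : IsFree ω x (Set.Ico s τ)) (hy : IsFree ω y (Set.Ioc τ t)) :
      Connected β ω (x, s) (y, t)
  | below (x y : V) (hxy : s(x, y) ∈ G.edgeSet) (τ s t : ℝ)
      (hω : ((⟨⟨s(x, y), hxy⟩, Kind.doubleBar⟩, τ) : Event G) ∈ ω)
      (hs : s < τ) (ht : t < τ)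
      (hx : IsFree ω x (Set.Ico s τ)) (hy : IsFree ω y (Set.Ico t τ)) :
      Connected β ω (x, s) (y, t)
  | above (x y : V) (hxy : s(x, y) ∈ G.edgeSet) (τ s t : ℝ)
      (hω : ((⟨⟨s(x, y), hxy⟩, Kind.doubleBar⟩, τ) : Event G) ∈ ω)
      (hs : τ < s) (ht : τ < t)
      (hx : IsFree ω x (Set.Ioc τ s)) (hy : IsFree ω y (Set.Ioc τ t)) :
      Connected β ω (x, s) (y, t)

/-- Two points are on the same loop if they are related by a chain of connections. -/
def loopSetoid (β : ℝ) (ω : Multiset (Event G)) : Setoid (RegularPoint β ω) :=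
  Relation.EqvGen.setoid fun p q => Connected β ω p.1 q.1

/-- The set `𝓛(ω)` of loops. -/
def Loop (β : ℝ) (ω : Multiset (Event G)) : Type _ := Quotient (loopSetoid β ω)

/-- `ℓ_x(γ)`: the total length of the vertical elements of the loop `γ` at the site `x`. -/
def loopLength {β : ℝ} {ω : Multiset (Event G)} (γ : Loop β ω) (x : V) : ℝ :=
  volume.real {t : ℝ | ∃ p : RegularPoint β ω, p.1 = (x, t) ∧ Quotient.mk (loopSetoid β ω) p = γ}

/-- `w(γ) = ∑_{a=-S}^S exp (a ∑_x h_x ℓ_x(γ))`. -/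
def loopWeight [Fintype V] (N : ℕ) (h : V → ℝ) {β : ℝ} {ω : Multiset (Event G)}
    (γ : Loop β ω) : ℝ :=
  ∑ i : Fin (N + 1), Real.exp (spin N i * ∑ x, h x * loopLength γ x)

end

end RandomLoop

/-! Let `D` be the diagonal field operator and `A` the sum over edges of `u T + (1 - u) Q`. Then
`-βH = β(D + A) - β|E|`, and `A` is the integral of the 0/1 matrices `markOp` against the intensity
of the marks. The interaction-picture function `e^{-sD} e^{s(D+A)}` solves a linear differential
equation. Its Picard series is the Dyson expansion of `e^{-βD} e^{β(D+A)}` into integrals of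
products of `e^{-sD} B_m e^{sD}` over time-ordered tuples of marked times (`hasSum_dyson`).

On the probabilistic side, almost every configuration has distinct times in `(0, β)`, so exactly one
of the `n!` enumerations of its points is time-ordered. This cancels the `1 / n!` of the Poisson law
and turns its integrals into series over the same tuples, with prefactor `e^{-β|E|}`
(`integral_poissonLaw`). That prefactor is the contribution of the `-1` in each bond.

It remains to match the integrands for one ordered tuple. Expanding `Tr(e^{βD} ⋯)` in the spin basis
gives a sum over periodic sequences of spin configurations compatible with the events, each weighted
by the exponential of its field energy integrated over time (`trace_exp_mul_orderedProd`). Such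
sequences are exactly the assignments of one spin value to each loop (`loopFunEquiv`), so the sum
factorizes into the product of the loop weights (`finprod_loopWeight`). -/

namespace RandomLoop

/-! ### Picard iteration for linear differential equations in a Banach algebra -/

section Picard

variable {𝔸 : Type*} [NormedRing 𝔸] [NormedAlgebra ℝ 𝔸]

/-- The Picard iterates of `L' = a L`, `L 0 = 1`. -/
noncomputable def picard (a : ℝ → 𝔸) : ℕ → ℝ → 𝔸
  | 0, _ => 1
  | n + 1, t => ∫ s in (0 : ℝ)..t, a s * picard a n s

theorem continuous_picard {a : ℝ → 𝔸} (ha : Continuous a) (n : ℕ) : Continuous (picard a n) := by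
  induction n with
  | zero => exact continuous_const
  | succ n ih =>
    exact intervalIntegral.continuous_primitive
      (fun s t => (ha.mul ih).intervalIntegrable s t) 0

variable [CompleteSpace 𝔸]

/-- Subtracting the Picard recursion from the integral equation `E = 1 + ∫ a E` shows that the
remainders obey the recursion of the iterates. -/
theorem sub_sum_picard_succ {a E : ℝ → 𝔸} (ha : Continuous a)
    (hE : ∀ s, HasDerivAt E (a s * E s) s) (hE0 : E 0 = 1) (n : ℕ) (t : ℝ) :
    E t - ∑ k ∈ Finset.range (n + 1), picard a k t =
      ∫ s in (0 : ℝ)..t, a s * (E s - ∑ k ∈ Finset.range n, picard a k s) := by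
  have hEc : Continuous E := continuous_iff_continuousAt.2 fun s => (hE s).continuousAt
  have h1 : ∫ s in (0 : ℝ)..t, a s * E s = E t - 1 := by
    rw [intervalIntegral.integral_eq_sub_of_hasDerivAt (fun s _ => hE s)
      ((ha.mul hEc).intervalIntegrable _ _), hE0]
  simp only [mul_sub, Finset.mul_sum]
  have h2 : ∀ k, Continuous fun s => a s * picard a k s := fun k =>
    ha.mul (continuous_picard ha k)
  have h3 : Continuous fun s => a s * E s := ha.mul hEc
  have h4 : Continuous fun s => ∑ k ∈ Finset.range n, a s * picard a k s :=
    continuous_finsetSum _ fun k _ => h2 k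
  rw [intervalIntegral.integral_sub (h3.intervalIntegrable _ _) (h4.intervalIntegrable _ _), h1,
    intervalIntegral.integral_finsetSum fun k _ => (h2 k).intervalIntegrable _ _,
    Finset.sum_range_succ']
  simp only [picard]
  abel

/-- The zeroth remainder is `E`, bounded by `K`; each further integration multiplies by `A` and
raises the power of `t`, which produces the factorial. -/
theorem norm_sub_sum_picard_le {a E : ℝ → 𝔸} (ha : Continuous a)
    (hE : ∀ s, HasDerivAt E (a s * E s) s) (hE0 : E 0 = 1) {b A K : ℝ}
    (hA : ∀ s ∈ Set.Icc 0 b, ‖a s‖ ≤ A) (hK : ∀ s ∈ Set.Icc 0 b, ‖E s‖ ≤ K) (n : ℕ) :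
    ∀ t ∈ Set.Icc 0 b,
      ‖E t - ∑ k ∈ Finset.range n, picard a k t‖ ≤ K * ((A * t) ^ n / n !) := by
  induction n with
  | zero => simpa using hK
  | succ n ih =>
    intro t ht
    rw [sub_sum_picard_succ ha hE hE0]
    have hA0 : 0 ≤ A := (norm_nonneg _).trans (hA t ht)
    have key : ∫ s in (0 : ℝ)..t, A * (K * ((A * s) ^ n / n !)) =
        K * ((A * t) ^ (n + 1) / (n + 1)!) := by
      have : ∀ s : ℝ, A * (K * ((A * s) ^ n / n !)) = A ^ (n + 1) * K / n ! * s ^ n := by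
        intro s; rw [mul_pow]; ring
      simp only [this]
      rw [intervalIntegral.integral_const_mul, integral_pow, Nat.factorial_succ, mul_pow]
      push_cast
      have h1 : (n ! : ℝ) ≠ 0 := by positivity
      have h2 : (n : ℝ) + 1 ≠ 0 := by positivity
      field_simp
      simp
    rw [← key]
    refine intervalIntegral.norm_integral_le_of_norm_le ht.1 (ae_of_all _ fun s hs => ?_)
      (Continuous.intervalIntegrable (by fun_prop) _ _)
    have hs' : s ∈ Set.Icc 0 b := ⟨hs.1.le, hs.2.trans ht.2⟩
    exact (norm_mul_le _ _).trans (mul_le_mul (hA s hs') (ih s hs') (norm_nonneg _) hA0)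

theorem hasSum_picard {a E : ℝ → 𝔸} (ha : Continuous a)
    (hE : ∀ s, HasDerivAt E (a s * E s) s) (hE0 : E 0 = 1) {b : ℝ} (hb : 0 ≤ b) :
    HasSum (fun n => picard a n b) (E b) := by
  have hEc : Continuous E := continuous_iff_continuousAt.2 fun s => (hE s).continuousAt
  obtain ⟨A, hA⟩ := isCompact_Icc.exists_bound_of_continuousOn (s := Set.Icc 0 b) ha.continuousOn
  obtain ⟨K, hK⟩ := isCompact_Icc.exists_bound_of_continuousOn (s := Set.Icc 0 b) hEc.continuousOn
  have hR := fun n => norm_sub_sum_picard_le ha hE hE0 hA hK n b ⟨hb, le_rfl⟩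
  have hs : Summable fun n : ℕ => K * ((A * b) ^ n / n !) :=
    (Real.summable_pow_div_factorial (A * b)).mul_left K
  have hsum : Summable fun n => picard a n b := by
    refine Summable.of_norm_bounded (hs.add ((summable_nat_add_iff 1).2 hs)) fun n => ?_
    -- An iterate is the difference of two consecutive remainders, so the remainder bound also gives
    -- summability.
    have : picard a n b = (E b - ∑ k ∈ Finset.range n, picard a k b) -
        (E b - ∑ k ∈ Finset.range (n + 1), picard a k b) := by
      rw [Finset.sum_range_succ]; abel
    rw [this]
    exact (norm_sub_le _ _).trans (add_le_add (hR n) (hR (n + 1)))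
  rw [hsum.hasSum_iff_tendsto_nat]
  have h0 : Filter.Tendsto (fun n => E b - ∑ k ∈ Finset.range n, picard a k b) Filter.atTop
      (nhds 0) := squeeze_zero_norm hR hs.tendsto_atTop_zero
  simpa using (tendsto_const_nhds (x := E b)).sub h0

end Picard

/-! ### Time-ordered products -/

section Ordered

variable {M : Type*} {𝔸 : Type*}

/-- Tuples of marked times in `(0, t)` whose times are strictly increasing. -/
def orderedTuples (M : Type*) (n : ℕ) (t : ℝ) : Set (Fin n → M × ℝ) :=
  {x | StrictMono (fun i => (x i).2) ∧ ∀ i, (x i).2 ∈ Set.Ioo 0 t}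

/-- The time simplex fibres over its latest time, the fibre being a simplex with that time as its
upper bound. This is the geometric form of the Picard recursion. -/
theorem snoc_mem_orderedTuples {n : ℕ} {t : ℝ} (x : Fin n → M × ℝ) (y : M × ℝ) :
    (Fin.snoc (α := fun _ => M × ℝ) x y) ∈ orderedTuples M (n + 1) t ↔
      y.2 ∈ Set.Ioo 0 t ∧ x ∈ orderedTuples M n y.2 := by
  constructor
  · rintro ⟨h1, h2⟩
    have hy := h2 (Fin.last n)
    simp only [Fin.snoc_last] at hy
    refine ⟨hy, fun i j hij => ?_, fun i => ?_⟩
    · simpa using h1 (Fin.castSucc_lt_castSucc_iff.2 hij)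
    · have h3 := h1 (Fin.castSucc_lt_last i)
      have h4 := h2 i.castSucc
      simp only [Fin.snoc_last, Fin.snoc_castSucc] at h3 h4
      exact ⟨h4.1, h3⟩
  · rintro ⟨hy, h1, h2⟩
    refine ⟨fun i j hij => ?_, fun i => ?_⟩
    · induction j using Fin.lastCases with
      | last =>
        induction i using Fin.lastCases with
        | last => exact absurd hij (lt_irrefl _)
        | cast i => simpa using (h2 i).2
      | cast j =>
        induction i using Fin.lastCases with
        | last => exact absurd hij (not_lt.2 (Fin.le_last _))
        | cast i => simpa using h1 (Fin.castSucc_lt_castSucc_iff.1 hij)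
    · induction i using Fin.lastCases with
      | last => simpa using hy
      | cast i => simpa using ⟨(h2 i).1, (h2 i).2.trans hy.2⟩

theorem measurableSet_orderedTuples [MeasurableSpace M] (n : ℕ) (t : ℝ) :
    MeasurableSet (orderedTuples M n t) := by
  have : orderedTuples M n t = (⋂ (i) (j) (_ : i < j), {x | (x i).2 < (x j).2}) ∩
      ⋂ i, {x | (x i).2 ∈ Set.Ioo 0 t} := by
    ext x; simp [orderedTuples, StrictMono]
  rw [this]
  refine MeasurableSet.inter ?_ ?_
  · refine MeasurableSet.iInter fun i => MeasurableSet.iInter fun j =>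
      MeasurableSet.iInter fun _ => ?_
    exact measurableSet_lt (measurable_pi_apply i).snd (measurable_pi_apply j).snd
  · exact MeasurableSet.iInter fun i => (measurable_pi_apply i).snd measurableSet_Ioo

/-- The product `C (xₙ₋₁) ⋯ C (x₀)`. -/
def orderedProd [Monoid 𝔸] (C : M × ℝ → 𝔸) : (n : ℕ) → (Fin n → M × ℝ) → 𝔸
  | 0, _ => 1
  | n + 1, x => C (x (Fin.last n)) * orderedProd C n (fun i => x i.castSucc)

theorem orderedProd_snoc [Monoid 𝔸] (C : M × ℝ → 𝔸) {n : ℕ} (x : Fin n → M × ℝ) (y : M × ℝ) :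
    orderedProd C (n + 1) (Fin.snoc (α := fun _ => M × ℝ) x y) = C y * orderedProd C n x := by
  simp [orderedProd]

theorem stronglyMeasurable_orderedProd [MeasurableSpace M] [Monoid 𝔸] [TopologicalSpace 𝔸]
    [ContinuousMul 𝔸] {C : M × ℝ → 𝔸} (hC : StronglyMeasurable C) (n : ℕ) :
    StronglyMeasurable (orderedProd C n) := by
  induction n with
  | zero => exact stronglyMeasurable_const
  | succ n ih =>
    exact (hC.comp_measurable (measurable_pi_apply _)).mul
      (ih.comp_measurable (measurable_pi_lambda _ fun i => measurable_pi_apply _))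

theorem norm_orderedProd_le [NormedRing 𝔸] [NormOneClass 𝔸] {C : M × ℝ → 𝔸} {b c : ℝ}
    (hc : 0 ≤ c) (hC : ∀ y, y.2 ∈ Set.Icc 0 b → ‖C y‖ ≤ c) (n : ℕ) (x : Fin n → M × ℝ)
    (hx : ∀ i, (x i).2 ∈ Set.Icc 0 b) : ‖orderedProd C n x‖ ≤ c ^ n := by
  induction n with
  | zero => simp [orderedProd]
  | succ n ih =>
    rw [orderedProd, pow_succ']
    exact (norm_mul_le _ _).trans
      (mul_le_mul (hC _ (hx _)) (ih _ fun i => hx _) (norm_nonneg _) hc)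

theorem integral_pi_succ {X E : Type*} [MeasurableSpace X] [NormedAddCommGroup E]
    [NormedSpace ℝ E] (μ : Measure X) [SigmaFinite μ] (n : ℕ) (f : (Fin (n + 1) → X) → E) :
    ∫ x, f x ∂(Measure.pi fun _ => μ) =
      ∫ p : X × (Fin n → X), f (Fin.snoc (α := fun _ => X) p.2 p.1) ∂(μ.prod (Measure.pi fun _ => μ)) := by
  have h := (measurePreserving_piFinSuccAbove (fun _ : Fin (n + 1) => μ) (Fin.last n)).symm
  rw [← h.integral_comp']
  refine integral_congr_ae (ae_of_all _ fun p => ?_)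
  show f (Fin.insertNth (Fin.last n) p.1 p.2) = _
  rw [Fin.insertNth_last']

variable [MeasurableSpace M] [NormedRing 𝔸] [NormedAlgebra ℝ 𝔸] [NormOneClass 𝔸]

/-- Fubini with the latest point outermost: that point carries the leftmost factor of the product
and bounds the times of all the others. -/
theorem setIntegral_orderedProd_succ (ν : Measure M) [IsFiniteMeasure ν] {C : M × ℝ → 𝔸}
    (hC : StronglyMeasurable C) {b c : ℝ} (hc : 0 ≤ c)
    (hCb : ∀ y, y.2 ∈ Set.Icc 0 b → ‖C y‖ ≤ c) (n : ℕ) {t : ℝ} (ht : t ∈ Set.Icc 0 b) :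
    ∫ x in orderedTuples M (n + 1) t, orderedProd C (n + 1) x
        ∂(Measure.pi fun _ => ν.prod (volume.restrict (Set.Icc 0 b))) =
      ∫ s in (0 : ℝ)..t, (∫ m, C (m, s) ∂ν) *
        ∫ x in orderedTuples M n s, orderedProd C n x
          ∂(Measure.pi fun _ => ν.prod (volume.restrict (Set.Icc 0 b))) := by
  set μ := ν.prod (volume.restrict (Set.Icc 0 b)) with hμ
  set f : (M × ℝ) × (Fin n → M × ℝ) → 𝔸 := fun p =>
    (orderedTuples M (n + 1) t).indicator (orderedProd C (n + 1))
      (Fin.snoc (α := fun _ => M × ℝ) p.2 p.1) with hf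
  have hfeq : ∀ p, f p = (Set.Ioo 0 t).indicator (fun _ => C p.1) p.1.2 *
      (orderedTuples M n p.1.2).indicator (orderedProd C n) p.2 := by
    intro p
    have hmem := snoc_mem_orderedTuples (t := t) p.2 p.1
    by_cases h : p.1.2 ∈ Set.Ioo 0 t ∧ p.2 ∈ orderedTuples M n p.1.2
    · rw [Set.indicator_of_mem h.1, Set.indicator_of_mem h.2]
      exact (Set.indicator_of_mem (hmem.2 h) _).trans (orderedProd_snoc C p.2 p.1)
    · refine (Set.indicator_of_notMem (fun h' => h (hmem.1 h')) _).trans (Eq.symm ?_)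
      rcases not_and_or.1 h with h | h
      · rw [Set.indicator_of_notMem h, zero_mul]
      · rw [Set.indicator_of_notMem h, mul_zero]
  have hsnoc : Measurable fun p : (M × ℝ) × (Fin n → M × ℝ) =>
      (Fin.snoc (α := fun _ => M × ℝ) p.2 p.1) := by
    refine measurable_pi_lambda _ fun i => ?_
    induction i using Fin.lastCases with
    | last => simpa using measurable_fst
    | cast i => simpa using measurable_snd.eval
  have hfm : StronglyMeasurable f :=
    ((stronglyMeasurable_orderedProd hC (n + 1)).indicator
      (measurableSet_orderedTuples _ _)).comp_measurable hsnoc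
  have hfb : ∀ p, ‖f p‖ ≤ c ^ (n + 1) := by
    intro p
    refine (norm_indicator_eq_indicator_norm _ _).le.trans ?_
    refine Set.indicator_apply_le' (fun h => ?_) fun _ => by positivity
    exact norm_orderedProd_le hc hCb _ _ fun i =>
      ⟨(h.2 i).1.le, (h.2 i).2.le.trans ht.2⟩
  have hfi : Integrable f (μ.prod (Measure.pi fun _ => μ)) :=
    Integrable.of_bound hfm.aestronglyMeasurable _ (ae_of_all _ hfb)
  rw [← integral_indicator (measurableSet_orderedTuples _ _), integral_pi_succ μ n]
  change ∫ p, f p ∂(μ.prod (Measure.pi fun _ => μ)) = _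
  rw [integral_prod _ hfi]
  have hin : ∀ y, ∫ x, f (y, x) ∂(Measure.pi fun _ => μ) =
      (Set.Ioo 0 t).indicator (fun _ => C y) y.2 *
        ∫ x in orderedTuples M n y.2, orderedProd C n x ∂(Measure.pi fun _ => μ) := by
    intro y
    rw [← integral_indicator (measurableSet_orderedTuples _ _)]
    simp only [hfeq]
    by_cases hy : y.2 ∈ Set.Ioo 0 t
    · refine integral_const_mul_of_integrable ?_
      refine Integrable.of_bound (((stronglyMeasurable_orderedProd hC n).indicator
        (measurableSet_orderedTuples _ _)).aestronglyMeasurable) (c ^ n) (ae_of_all _ fun x => ?_)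
      refine (norm_indicator_eq_indicator_norm _ _).le.trans ?_
      refine Set.indicator_apply_le' (fun h => ?_) fun _ => by positivity
      exact norm_orderedProd_le hc hCb _ _ fun i =>
        ⟨(h.2 i).1.le, (h.2 i).2.le.trans (hy.2.le.trans ht.2)⟩
    · simp [hy]
  have hgi := hfi.integral_prod_left
  simp only [hin] at hgi ⊢
  -- Time becomes the outer variable, so that the mark is integrated out at fixed time.
  rw [hμ, integral_prod_symm _ hgi, intervalIntegral.integral_of_le ht.1,
    integral_Ioc_eq_integral_Ioo, ← hμ]
  have hsub : Set.Ioo 0 t ⊆ Set.Icc 0 b := fun s hs => ⟨hs.1.le, hs.2.le.trans ht.2⟩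
  conv_rhs => rw [← Set.inter_eq_right.2 hsub, ← setIntegral_indicator measurableSet_Ioo]
  refine integral_congr_ae (ae_of_all _ fun s => ?_)
  by_cases hs : s ∈ Set.Ioo 0 t
  · simp only [Set.indicator_of_mem hs]
    refine integral_mul_const_of_integrable ?_
    exact Integrable.of_bound
      (hC.comp_measurable measurable_prodMk_right).aestronglyMeasurable c
      (ae_of_all _ fun m => hCb _ (hsub hs))
  · simp [hs]

theorem setIntegral_orderedProd_eq_picard [CompleteSpace 𝔸] (ν : Measure M) [IsFiniteMeasure ν] {C : M × ℝ → 𝔸}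
    (hC : StronglyMeasurable C) {b c : ℝ} (hc : 0 ≤ c)
    (hCb : ∀ y, y.2 ∈ Set.Icc 0 b → ‖C y‖ ≤ c) (n : ℕ) :
    ∀ t ∈ Set.Icc 0 b, ∫ x in orderedTuples M n t, orderedProd C n x
        ∂(Measure.pi fun _ => ν.prod (volume.restrict (Set.Icc 0 b))) =
      picard (fun s => ∫ m, C (m, s) ∂ν) n t := by
  induction n with
  | zero =>
    intro t _
    have : orderedTuples M 0 t = Set.univ := by
      ext x; simp [orderedTuples, Subsingleton.strictMono]
    rw [this, Measure.restrict_univ]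
    simp [orderedProd, picard, Measure.real]
  | succ n ih =>
    intro t ht
    rw [setIntegral_orderedProd_succ ν hC hc hCb n ht, picard]
    refine intervalIntegral.integral_congr fun s hs => ?_
    rw [Set.uIcc_of_le ht.1] at hs
    simp only [ih s ⟨hs.1, hs.2.trans ht.2⟩]

/-- The operator `e^{-sD} B_m e^{sD}` attached to the marked time `(m, s)`. -/
noncomputable def interaction {M 𝔸 : Type*} [NormedRing 𝔸] [NormedAlgebra ℝ 𝔸] (D : 𝔸) (B : M → 𝔸)
    (y : M × ℝ) : 𝔸 :=
  NormedSpace.exp (-y.2 • D) * B y.1 * NormedSpace.exp (y.2 • D)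

/-! ### The interaction picture and the Dyson series. -/

variable [CompleteSpace 𝔸]

omit [NormOneClass 𝔸] in
theorem continuous_exp_smul (D : 𝔸) : Continuous fun s : ℝ => NormedSpace.exp (s • D) :=
  continuous_iff_continuousAt.2 fun s => (hasDerivAt_exp_smul_const D s).continuousAt

omit [NormOneClass 𝔸] in
theorem exp_smul_mul_exp_neg_smul (D : 𝔸) (s : ℝ) :
    NormedSpace.exp (s • D) * NormedSpace.exp (-s • D) = 1 := by
  let _ : NormedAlgebra ℚ 𝔸 := NormedAlgebra.restrictScalars ℚ ℝ 𝔸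
  rw [← NormedSpace.exp_add_of_commute]
  · simp
  · exact ((Commute.refl D).smul_left _).smul_right _

omit [NormOneClass 𝔸] in
theorem stronglyMeasurable_interaction {B : M → 𝔸} (hB : StronglyMeasurable B) (D : 𝔸) :
    StronglyMeasurable (interaction D B) :=
  ((((continuous_exp_smul D).comp continuous_neg).stronglyMeasurable.comp_measurable
      measurable_snd).mul (hB.comp_measurable measurable_fst)).mul
    ((continuous_exp_smul D).stronglyMeasurable.comp_measurable measurable_snd)

omit [NormOneClass 𝔸] [MeasurableSpace M] in
theorem exists_norm_interaction_le {B : M → 𝔸} {k : ℝ} (hk : ∀ m, ‖B m‖ ≤ k) (D : 𝔸) (b : ℝ) :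
    ∃ c, 0 ≤ c ∧ ∀ y : M × ℝ, y.2 ∈ Set.Icc 0 b → ‖interaction D B y‖ ≤ c := by
  obtain ⟨K₁, hK₁⟩ := isCompact_Icc.exists_bound_of_continuousOn (s := Set.Icc 0 b)
    ((continuous_exp_smul D).comp continuous_neg).continuousOn
  obtain ⟨K₂, hK₂⟩ := isCompact_Icc.exists_bound_of_continuousOn (s := Set.Icc 0 b)
    (continuous_exp_smul D).continuousOn
  -- The absolute value covers an empty `M` or an empty interval, where the bounds may be negative.
  refine ⟨|K₁ * k * K₂|, abs_nonneg _, fun y hy => le_trans ?_ (le_abs_self _)⟩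
  have h1 := hK₁ _ hy
  have h2 := hk y.1
  exact (norm_mul_le _ _).trans (mul_le_mul ((norm_mul_le _ _).trans
    (mul_le_mul h1 h2 (norm_nonneg _) ((norm_nonneg _).trans h1))) (hK₂ _ hy) (norm_nonneg _)
    (mul_nonneg ((norm_nonneg _).trans h1) ((norm_nonneg _).trans h2)))

/-- The Dyson expansion of `e^{-bD} e^{b(D+A)}`, where `A = ∫ B dν`. -/
theorem hasSum_dyson (ν : Measure M) [IsFiniteMeasure ν] {B : M → 𝔸}
    (hB : StronglyMeasurable B) {k : ℝ} (hk : ∀ m, ‖B m‖ ≤ k) (D : 𝔸) {b : ℝ} (hb : 0 ≤ b) :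
    HasSum (fun n => ∫ x in orderedTuples M n b, orderedProd (interaction D B) n x
        ∂(Measure.pi fun _ => ν.prod (volume.restrict (Set.Icc 0 b))))
      (NormedSpace.exp (-b • D) * NormedSpace.exp (b • (D + ∫ m, B m ∂ν))) := by
  have hexp := continuous_exp_smul (𝔸 := 𝔸)
  have hexpn : Continuous fun s : ℝ => NormedSpace.exp (-s • D) := (hexp D).comp continuous_neg
  obtain ⟨c, hc, hCb⟩ := exists_norm_interaction_le hk D b
  have hBi : Integrable B ν := Integrable.of_bound hB.aestronglyMeasurable k (ae_of_all _ hk)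
  have ha : (fun s => ∫ m, interaction D B (m, s) ∂ν) =
      fun s => NormedSpace.exp (-s • D) * (∫ m, B m ∂ν) * NormedSpace.exp (s • D) := by
    funext s
    rw [← integral_const_mul_of_integrable hBi, ← integral_mul_const_of_integrable]
    · rfl
    · exact hBi.const_mul' _
  simp only [fun n => setIntegral_orderedProd_eq_picard ν (stronglyMeasurable_interaction hB D)
    hc hCb n b ⟨hb, le_rfl⟩, ha]
  -- With `A = ∫ B dν`, the derivative of `e^{-sD} e^{s(D+A)}` is `e^{-sD} A e^{s(D+A)}`. Inserting
  -- `e^{sD} e^{-sD} = 1` after `A` puts it in the form `a(s) E(s)`.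
  refine hasSum_picard (E := fun s : ℝ => NormedSpace.exp (-s • D) *
    NormedSpace.exp (s • (D + ∫ m, B m ∂ν))) ?_ (fun s => ?_) (by simp) hb
  · exact (hexpn.mul continuous_const).mul (hexp D)
  · have h1 : HasDerivAt (fun s : ℝ => NormedSpace.exp (-s • D))
        (-(NormedSpace.exp (-s • D) * D)) s := by
      have := (hasDerivAt_exp_smul_const D (-s)).scomp s (hasDerivAt_neg s)
      rwa [neg_one_smul] at this
    have h2 := hasDerivAt_exp_smul_const' (𝕂 := ℝ) (D + ∫ m, B m ∂ν) s
    refine (h1.mul h2).congr_deriv (Eq.symm ?_)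
    calc NormedSpace.exp (-s • D) * (∫ m, B m ∂ν) * NormedSpace.exp (s • D) *
          (NormedSpace.exp (-s • D) * NormedSpace.exp (s • (D + ∫ m, B m ∂ν)))
        = NormedSpace.exp (-s • D) * (∫ m, B m ∂ν) *
          (NormedSpace.exp (s • D) * NormedSpace.exp (-s • D)) *
          NormedSpace.exp (s • (D + ∫ m, B m ∂ν)) := by simp only [mul_assoc]
      _ = _ := by rw [exp_smul_mul_exp_neg_smul]; noncomm_ring

end Ordered

/-! ### Integration against the law of a marked Poisson process -/

section Poisson

variable {M : Type*}

theorem toConfig_comp_perm {X : Type*} {n : ℕ} (x : Fin n → X) (π : Equiv.Perm (Fin n)) :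
    toConfig n (x ∘ π) = toConfig n x := by
  simp only [toConfig, ← Multiset.map_map]
  congr 1
  simp

theorem mem_toConfig {X : Type*} {n : ℕ} {x : Fin n → X} {e : X} :
    e ∈ toConfig n x ↔ ∃ i, x i = e := by
  simp [toConfig]

/-- Configurations with distinct times, all of them in `(0, b)`. -/
def simpleConfigs (M : Type*) (b : ℝ) : Set (Multiset (M × ℝ)) :=
  {ω | (ω.map Prod.snd).Nodup ∧ ∀ e ∈ ω, e.2 ∈ Set.Ioo 0 b}

theorem toConfig_mem_simpleConfigs {n : ℕ} {b : ℝ} {x : Fin n → M × ℝ} :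
    toConfig n x ∈ simpleConfigs M b ↔
      Function.Injective (fun i => (x i).2) ∧ ∀ i, (x i).2 ∈ Set.Ioo 0 b := by
  simp only [simpleConfigs, Set.mem_ofPred_eq, mem_toConfig, forall_exists_index,
    forall_apply_eq_imp_iff]
  refine and_congr_left fun _ => ?_
  rw [toConfig, Multiset.map_map]
  exact ⟨fun h i j hij => Multiset.inj_on_of_nodup_map h i (Finset.mem_univ i) j
    (Finset.mem_univ j) hij, fun h => (Multiset.nodup_map_iff_of_injective h).2 Finset.univ.nodup⟩

/-- Sorting by time gives existence. Two strictly increasing enumerations of the same set of times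
coincide, and distinct times identify the indices, which gives uniqueness. -/
theorem existsUnique_perm_mem_orderedTuples {n : ℕ} {b : ℝ} {x : Fin n → M × ℝ}
    (hx : toConfig n x ∈ simpleConfigs M b) :
    ∃! π : Equiv.Perm (Fin n), x ∘ π ∈ orderedTuples M n b := by
  rw [toConfig_mem_simpleConfigs] at hx
  refine ⟨Tuple.sort fun i => (x i).2, ⟨?_, fun i => hx.2 _⟩, fun π hπ => ?_⟩
  · exact (Tuple.monotone_sort _).strictMono_of_injective (hx.1.comp (Equiv.injective _))
  · have h1 : StrictMono ((fun i => (x i).2) ∘ Tuple.sort fun i => (x i).2) :=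
      (Tuple.monotone_sort _).strictMono_of_injective (hx.1.comp (Equiv.injective _))
    have h2 : StrictMono ((fun i => (x i).2) ∘ π) := hπ.1
    have h3 := (h2.range_inj h1).1 (by simp [Set.range_comp])
    exact Equiv.ext fun i => hx.1 (congrFun h3 i)

theorem mem_simpleConfigs_of_perm {n : ℕ} {b : ℝ} {x : Fin n → M × ℝ} {π : Equiv.Perm (Fin n)}
    (h : x ∘ π ∈ orderedTuples M n b) : toConfig n x ∈ simpleConfigs M b := by
  rw [← toConfig_comp_perm x π, toConfig_mem_simpleConfigs]
  exact ⟨h.1.injective, h.2⟩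

/-- Exactly one term survives for a simple configuration and none otherwise. The identity recovers a
symmetric functional from its values on the ordered chamber, and thereby its measurability. -/
theorem sum_perm_indicator_orderedTuples {E : Type*} [AddCommMonoid E] {n : ℕ} {b : ℝ}
    {F : Multiset (M × ℝ) → E} {g : (Fin n → M × ℝ) → E}
    (hFg : ∀ x ∈ orderedTuples M n b, F (toConfig n x) = g x) (x : Fin n → M × ℝ) :
    ∑ π : Equiv.Perm (Fin n), (orderedTuples M n b).indicator g (x ∘ π) =
      (simpleConfigs M b).indicator F (toConfig n x) := by
  by_cases hx : toConfig n x ∈ simpleConfigs M b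
  · obtain ⟨π, hπ, huniq⟩ := existsUnique_perm_mem_orderedTuples hx
    rw [Finset.sum_eq_single π, Set.indicator_of_mem hπ, Set.indicator_of_mem hx, ← hFg _ hπ,
      toConfig_comp_perm]
    · exact fun π' _ hne => Set.indicator_of_notMem (fun h => hne (huniq _ h)) _
    · exact fun h => absurd (Finset.mem_univ _) h
  · rw [Set.indicator_of_notMem hx]
    exact Finset.sum_eq_zero fun π _ =>
      Set.indicator_of_notMem (fun h => hx (mem_simpleConfigs_of_perm h)) _

/-! ### Measurability on configurations, almost sure simplicity, and symmetrization. -/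

variable [MeasurableSpace M]

theorem measurable_toConfig {X : Type*} [MeasurableSpace X] (n : ℕ) :
    Measurable (toConfig (X := X) n) := fun _ hs =>
  (MeasurableSpace.measurableSet_iInf.1 hs) n

theorem measurable_of_comp_toConfig {X Y : Type*} [MeasurableSpace X] [MeasurableSpace Y]
    {F : Multiset X → Y} (h : ∀ n, Measurable fun x => F (toConfig n x)) : Measurable F :=
  fun _ hs => MeasurableSpace.measurableSet_iInf.2 fun n => h n hs

/-- Lebesgue measure has no atoms, so hitting an endpoint and the coincidence of two times are null
events. -/
theorem ae_mem_simpleConfigs (ν : Measure M) [IsFiniteMeasure ν] (b : ℝ) (n : ℕ) :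
    ∀ᵐ x ∂(Measure.pi fun _ : Fin n => ν.prod (volume.restrict (Set.Icc 0 b))),
      toConfig n x ∈ simpleConfigs M b := by
  set μ := ν.prod (volume.restrict (Set.Icc 0 b)) with hμ
  have hsnd : Measure.QuasiMeasurePreserving Prod.snd μ (volume.restrict (Set.Icc 0 b)) :=
    Measure.quasiMeasurePreserving_snd
  have h1 : ∀ i : Fin n, ∀ᵐ x ∂(Measure.pi fun _ : Fin n => μ), (x i).2 ∈ Set.Ioo 0 b := by
    intro i
    refine (hsnd.comp (Measure.quasiMeasurePreserving_eval (fun _ : Fin n => μ) i)).ae ?_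
    rw [← Measure.restrict_congr_set Ioo_ae_eq_Icc]
    exact ae_restrict_mem measurableSet_Ioo
  have h2 : ∀ i j : Fin n, i ≠ j →
      ∀ᵐ x ∂(Measure.pi fun _ : Fin n => μ), (x i).2 ≠ (x j).2 := by
    intro i j hij
    obtain _ | n := n
    · exact i.elim0
    -- Coordinate `i` is split off; once it is fixed, coincidence asks coordinate `k` of the rest to
    -- hit one given time.
    obtain ⟨k, rfl⟩ := Fin.exists_succAbove_eq hij.symm
    refine (measurePreserving_piFinSuccAbove (fun _ : Fin (n + 1) => μ) i).quasiMeasurePreserving.ae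
      (p := fun p : (M × ℝ) × (Fin n → M × ℝ) => p.1.2 ≠ (p.2 k).2) ?_
    have hm : MeasurableSet {p : (M × ℝ) × (Fin n → M × ℝ) | p.1.2 = (p.2 k).2} :=
      measurableSet_eq_fun measurable_fst.snd measurable_snd.eval.snd
    rw [ae_iff]
    simp only [ne_eq, not_not]
    rw [Measure.measure_prod_null hm]
    refine ae_of_all _ fun y => ?_
    have h3 : ∀ᵐ x ∂(Measure.pi fun _ : Fin n => μ), (x k).2 ≠ y.2 := by
      refine (hsnd.comp (Measure.quasiMeasurePreserving_eval (fun _ : Fin n => μ) k)).ae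
        (p := fun s => s ≠ y.2) ?_
      exact Measure.ae_ne _ _
    have h4 := ae_iff.1 h3
    simp only [ne_eq, not_not, eq_comm (b := y.2)] at h4
    exact h4
  filter_upwards [ae_all_iff.2 h1, ae_all_iff.2 fun i => ae_all_iff.2 fun j =>
    ae_all_iff.2 (h2 i j)] with x hx1 hx2
  refine toConfig_mem_simpleConfigs.2 ⟨fun i j hij => ?_, hx1⟩
  by_contra hne
  exact hx2 i j hne hij

/-- `arrowCongr'` precomposes with the inverse of its equivalence, so `π.symm` yields `x ↦ x ∘ π`.
-/
theorem measurePreserving_comp_perm {X : Type*} [MeasurableSpace X] (μ : Measure X)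
    [SigmaFinite μ] {n : ℕ} (π : Equiv.Perm (Fin n)) :
    MeasurePreserving (MeasurableEquiv.arrowCongr' π.symm (MeasurableEquiv.refl X))
      (Measure.pi fun _ => μ) (Measure.pi fun _ => μ) :=
  measurePreserving_arrowCongr' (fun _ : Fin n => μ) (fun _ : Fin n => μ) π.symm
    (MeasurableEquiv.refl X) fun _ => MeasurePreserving.id μ

theorem integral_comp_perm {X E : Type*} [MeasurableSpace X] [NormedAddCommGroup E]
    [NormedSpace ℝ E] (μ : Measure X) [SigmaFinite μ] {n : ℕ} (π : Equiv.Perm (Fin n))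
    (f : (Fin n → X) → E) :
    ∫ x, f (x ∘ π) ∂(Measure.pi fun _ => μ) = ∫ x, f x ∂(Measure.pi fun _ => μ) :=
  (measurePreserving_comp_perm μ π).integral_comp' f

/-- The integral of a functional of a Poisson process of marked times is expanded over the
time-ordered tuples. -/
theorem integral_poissonLaw (ν : Measure M) [IsFiniteMeasure ν] (b : ℝ)
    {F : Multiset (M × ℝ) → ℂ} {g : ∀ n, (Fin n → M × ℝ) → ℂ}
    (hg : ∀ n, StronglyMeasurable (g n))
    (hFg : ∀ n, ∀ x ∈ orderedTuples M n b, F (toConfig n x) = g n x) {K c : ℝ}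
    (hgb : ∀ n, ∀ x ∈ orderedTuples M n b, ‖g n x‖ ≤ K * c ^ n) :
    Integrable F (poissonLaw (ν.prod (volume.restrict (Set.Icc 0 b)))) ∧
      HasSum (fun n => Real.exp (-(ν.prod (volume.restrict (Set.Icc 0 b))).real Set.univ) •
          ∫ x in orderedTuples M n b, g n x
            ∂(Measure.pi fun _ => ν.prod (volume.restrict (Set.Icc 0 b))))
        (∫ ω, F ω ∂(poissonLaw (ν.prod (volume.restrict (Set.Icc 0 b))))) := by
  set μ := ν.prod (volume.restrict (Set.Icc 0 b)) with hμ
  set r := Real.exp (-μ.real Set.univ) with hr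
  have hr0 : 0 < r := Real.exp_pos _
  -- `F` is controlled only on simple configurations. This modification is measurable, being a
  -- symmetrized sum, and agrees with `F` almost everywhere.
  set F' := (simpleConfigs M b).indicator F with hF'
  have hind : ∀ n, StronglyMeasurable ((orderedTuples M n b).indicator (g n)) := fun n =>
    (hg n).indicator (measurableSet_orderedTuples _ _)
  have hperm : ∀ n (π : Equiv.Perm (Fin n)),
      Measurable fun x : Fin n → M × ℝ => x ∘ π := fun n π =>
    measurable_pi_lambda _ fun i => measurable_pi_apply _
  have hsum := fun n x => sum_perm_indicator_orderedTuples (hFg n) x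
  have hF'm : Measurable F' := by
    refine measurable_of_comp_toConfig fun n => ?_
    simp only [hF', ← hsum n]
    exact Finset.measurable_sum _ fun π _ => (hind n).measurable.comp (hperm n π)
  have hae : ∀ n, ∀ᵐ x ∂(Measure.pi fun _ : Fin n => μ), F (toConfig n x) = F' (toConfig n x) :=
    fun n => (ae_mem_simpleConfigs ν b n).mono fun x hx => (Set.indicator_of_mem hx _).symm
  have hsm : MeasurableSet (simpleConfigs M b) := by
    have h1 : ∀ n, Measurable fun x : Fin n → M × ℝ =>
        (simpleConfigs M b).indicator (fun _ => (1 : ℝ)) (toConfig n x) := by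
      intro n
      -- The symmetrization identity for the constant 1 writes the indicator of the simple
      -- configurations as a measurable sum.
      simp only [← sum_perm_indicator_orderedTuples (b := b) (F := fun _ => (1 : ℝ))
        (g := fun _ : Fin n → M × ℝ => (1 : ℝ)) (fun _ _ => rfl)]
      exact Finset.measurable_sum _ fun π _ => (measurable_const.indicator
        (measurableSet_orderedTuples _ _)).comp (hperm n π)
    exact (measurable_indicator_const_iff (1 : ℝ)).1 (measurable_of_comp_toConfig h1)
  have haemap : ∀ n, F =ᵐ[(Measure.pi fun _ : Fin n => μ).map (toConfig n)] F' := by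
    intro n
    have : ∀ᵐ ω ∂(Measure.pi fun _ : Fin n => μ).map (toConfig n), ω ∈ simpleConfigs M b :=
      (ae_map_iff (measurable_toConfig n).aemeasurable hsm).2 (ae_mem_simpleConfigs ν b n)
    exact this.mono fun ω hω => (Set.indicator_of_mem hω _).symm
  have hFsm : ∀ n, AEStronglyMeasurable F ((Measure.pi fun _ : Fin n => μ).map (toConfig n)) :=
    fun n => hF'm.aestronglyMeasurable.congr (haemap n).symm
  have hbound : ∀ n, ∀ᵐ x ∂(Measure.pi fun _ : Fin n => μ), ‖F (toConfig n x)‖ ≤ K * c ^ n := by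
    intro n
    filter_upwards [ae_mem_simpleConfigs ν b n] with x hx
    obtain ⟨π, hπ, -⟩ := existsUnique_perm_mem_orderedTuples hx
    rw [← toConfig_comp_perm x π, hFg n _ hπ]
    exact hgb n _ hπ
  have hFcomp : ∀ n, Integrable (fun x => F (toConfig n x)) (Measure.pi fun _ : Fin n => μ) :=
    fun n => Integrable.of_bound ((hFsm n).comp_measurable (measurable_toConfig n)) _ (hbound n)
  have hcoef : ∀ n : ℕ, (ENNReal.ofReal r / (n ! : ℝ≥0∞)).toReal = r / n ! := by
    intro n; simp [ENNReal.toReal_div, hr0.le]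
  have hcoef' : ∀ n : ℕ, ENNReal.ofReal r / (n ! : ℝ≥0∞) ≠ ⊤ := fun n =>
    ENNReal.div_ne_top ENNReal.ofReal_ne_top (by simp [Nat.factorial_ne_zero])
  have hint : Integrable F (poissonLaw μ) := by
    refine integrable_sum_measure (fun n => Integrable.smul_measure
      ((integrable_map_measure (hFsm n) (measurable_toConfig n).aemeasurable).2 (hFcomp n))
      (hcoef' n)) ?_
    have hsumm : Summable fun n : ℕ => r * K * ((c * μ.real Set.univ) ^ n / n !) :=
      (Real.summable_pow_div_factorial _).mul_left _
    refine hsumm.of_nonneg_of_le (fun n => integral_nonneg fun _ => norm_nonneg _) fun n => ?_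
    rw [integral_smul_measure, hcoef,
      integral_map (measurable_toConfig n).aemeasurable (hFsm n).norm]
    have h1 : ∫ x, ‖F (toConfig n x)‖ ∂(Measure.pi fun _ : Fin n => μ) ≤
        ∫ _, K * c ^ n ∂(Measure.pi fun _ : Fin n => μ) :=
      integral_mono_ae (hFcomp n).norm (integrable_const _) (hbound n)
    have h2 : (Measure.pi fun _ : Fin n => μ).real Set.univ = μ.real Set.univ ^ n := by
      simp [Measure.real, Measure.pi_univ]
    rw [integral_const, h2, smul_eq_mul] at h1
    rw [smul_eq_mul]
    refine (mul_le_mul_of_nonneg_left h1 (by positivity)).trans (le_of_eq ?_)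
    rw [mul_pow]; ring
  refine ⟨hint, ?_⟩
  refine (hasSum_integral_measure hint).congr_fun fun n => ?_
  rw [integral_smul_measure, hcoef, integral_map (measurable_toConfig n).aemeasurable (hFsm n),
    integral_congr_ae (hae n)]
  -- The integrand becomes a sum of `n!` permuted copies with equal integrals, and this factor
  -- cancels the `1 / n!` of the law.
  simp only [hF', ← hsum n]
  have hii : Integrable ((orderedTuples M n b).indicator (g n)) (Measure.pi fun _ => μ) := by
    refine Integrable.of_bound (hind n).aestronglyMeasurable |K * c ^ n| (ae_of_all _ fun x => ?_)
    refine (norm_indicator_eq_indicator_norm _ _).le.trans ?_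
    exact Set.indicator_apply_le' (fun h => (hgb n x h).trans (le_abs_self _))
      fun _ => abs_nonneg _
  have hiπ : ∀ π : Equiv.Perm (Fin n), Integrable
      (fun x => (orderedTuples M n b).indicator (g n) (x ∘ π)) (Measure.pi fun _ => μ) :=
    fun π => (measurePreserving_comp_perm μ π).integrable_comp_of_integrable hii
  rw [integral_finsetSum _ fun π _ => hiπ π]
  simp only [integral_comp_perm μ _ ((orderedTuples M n b).indicator (g n))]
  rw [integral_indicator (measurableSet_orderedTuples _ _), Finset.sum_const, Finset.card_univ,
    Fintype.card_perm, Fintype.card_fin, ← Nat.cast_smul_eq_nsmul ℝ, smul_smul,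
    div_mul_cancel₀ _ (by positivity)]

end Poisson

/-! ### Loops and space-time spin configurations -/

section Segments

variable {M : Type*} {n : ℕ} {b : ℝ}

/-- The initial time of the `k`-th of the `n + 1` intervals cut out by `n` ordered times. -/
def segStart (x : Fin n → M × ℝ) : Fin (n + 1) → ℝ := Fin.cons 0 fun i => (x i).2

/-- The final time of the `k`-th of the `n + 1` intervals cut out by `n` ordered times. -/
def segEnd (b : ℝ) (x : Fin n → M × ℝ) : Fin (n + 1) → ℝ :=
  Fin.snoc (α := fun _ => ℝ) (fun i => (x i).2) b

/-- A canonical representative of each interval; for ordered tuples it avoids all event times. -/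
noncomputable def segMid (b : ℝ) (x : Fin n → M × ℝ) (k : Fin (n + 1)) : ℝ :=
  (segStart x k + segEnd b x k) / 2

/-- The interval that contains the time `s`. -/
noncomputable def segOf (x : Fin n → M × ℝ) (s : ℝ) : Fin (n + 1) :=
  -- The strict inequality assigns an event time to the interval that it closes.
  ⟨(Finset.univ.filter fun i => (x i).2 < s).card,
    Nat.lt_succ_of_le ((Finset.card_le_univ _).trans_eq (Fintype.card_fin n))⟩

variable {x : Fin n → M × ℝ} (hx : x ∈ orderedTuples M n b)

@[simp] theorem segStart_zero : segStart x 0 = 0 := rfl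

@[simp] theorem segStart_succ (i : Fin n) : segStart x i.succ = (x i).2 := rfl

@[simp] theorem segEnd_last : segEnd b x (Fin.last n) = b := by simp [segEnd]

@[simp] theorem segEnd_castSucc (i : Fin n) : segEnd b x i.castSucc = (x i).2 := by simp [segEnd]

include hx

/-- Since the times are sorted, those below `s` form an initial segment, which is determined by its
cardinality. -/
theorem time_lt_iff {i : Fin n} {s : ℝ} : (x i).2 < s ↔ i.castSucc < segOf x s :=
  (Tuple.lt_card_lt_iff_apply_lt_of_monotone (f := fun i => (x i).2) (a := s)
    hx.1.monotone).symm

theorem segOf_eq {s : ℝ} {k : Fin (n + 1)} (h : ∀ i, (x i).2 < s ↔ i.castSucc < k) :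
    segOf x s = k := by
  have h' : ∀ i : Fin n, i.castSucc < segOf x s ↔ i.castSucc < k := fun i => by
    rw [← time_lt_iff hx, h]
  rcases lt_trichotomy (segOf x s) k with hlt | heq | hlt
  · obtain ⟨j, hj⟩ := Fin.exists_castSucc_eq.2 (hlt.trans_le (Fin.le_last _)).ne
    exact absurd ((h' j).2 (hj ▸ hlt)) (hj ▸ lt_irrefl _)
  · exact heq
  · obtain ⟨j, hj⟩ := Fin.exists_castSucc_eq.2 (hlt.trans_le (Fin.le_last _)).ne
    exact absurd ((h' j).1 (hj ▸ hlt)) (hj ▸ lt_irrefl _)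

theorem segOf_zero : segOf x 0 = 0 :=
  segOf_eq hx fun j => by simpa using (hx.2 j).1.le

theorem segOf_end : segOf x b = Fin.last n :=
  segOf_eq hx fun j => by simpa [Fin.castSucc_lt_last] using (hx.2 j).2

theorem time_le_segStart {i : Fin n} {k : Fin (n + 1)} (h : i.castSucc < k) :
    (x i).2 ≤ segStart x k := by
  induction k using Fin.cases with
  | zero => exact absurd h (Fin.not_lt_zero _)
  | succ j => exact hx.1.monotone (Fin.castSucc_lt_succ_iff.1 h)

theorem segEnd_le_time {i : Fin n} {k : Fin (n + 1)} (h : k ≤ i.castSucc) :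
    segEnd b x k ≤ (x i).2 := by
  induction k using Fin.lastCases with
  | last => exact absurd h (not_le.2 (Fin.castSucc_lt_last i))
  | cast j =>
    rw [segEnd_castSucc]
    exact hx.1.monotone (Fin.castSucc_le_castSucc_iff.1 h)

theorem segStart_lt_segEnd (hb : 0 < b) (k : Fin (n + 1)) : segStart x k < segEnd b x k := by
  induction k using Fin.cases with
  | zero =>
    obtain h | ⟨j, h⟩ := (Fin.eq_castSucc_or_eq_last (0 : Fin (n + 1))).symm
    · rw [h, segEnd_last, ← h]; exact hb
    · rw [h, segEnd_castSucc, ← h]; exact (hx.2 j).1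
  | succ i =>
    obtain h | ⟨j, h⟩ := (Fin.eq_castSucc_or_eq_last i.succ).symm
    · rw [h, segEnd_last, ← h]; exact (hx.2 i).2
    · rw [h, segEnd_castSucc, ← h]
      exact hx.1 (Fin.castSucc_lt_castSucc_iff.1 (h ▸ Fin.castSucc_lt_succ))

/-- The index `i` serves only as a witness: an event time in `(0, b)` forces `0 < b`. -/
theorem segStart_lt_segEnd_of_time (i : Fin n) (k : Fin (n + 1)) :
    segStart x k < segEnd b x k :=
  segStart_lt_segEnd hx ((hx.2 i).1.trans (hx.2 i).2) k

theorem segStart_lt_segMid (i : Fin n) (k : Fin (n + 1)) : segStart x k < segMid b x k := by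
  have := segStart_lt_segEnd_of_time hx i k
  rw [segMid]; linarith

theorem segMid_lt_segEnd (i : Fin n) (k : Fin (n + 1)) : segMid b x k < segEnd b x k := by
  have := segStart_lt_segEnd_of_time hx i k
  rw [segMid]; linarith

theorem segStart_nonneg (k : Fin (n + 1)) : 0 ≤ segStart x k := by
  induction k using Fin.cases with
  | zero => exact le_rfl
  | succ j => exact (hx.2 j).1.le

theorem segEnd_le (k : Fin (n + 1)) : segEnd b x k ≤ b := by
  induction k using Fin.lastCases with
  | last => rw [segEnd_last]
  | cast j => rw [segEnd_castSucc]; exact (hx.2 j).2.le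

theorem segStart_le_segEnd (hb : 0 ≤ b) (k : Fin (n + 1)) : segStart x k ≤ segEnd b x k := by
  rcases hb.eq_or_lt with rfl | hb
  · obtain _ | n := n
    · obtain rfl : k = Fin.last 0 := Fin.eq_of_val_eq (by omega)
      exact (segEnd_last (b := 0) (x := x)).ge
    · exact (segStart_lt_segEnd_of_time hx 0 k).le
  · exact (segStart_lt_segEnd hx hb k).le

theorem segMid_mem_Icc (hb : 0 ≤ b) (k : Fin (n + 1)) : segMid b x k ∈ Set.Icc 0 b := by
  have h1 := segStart_le_segEnd hx hb k
  have h2 := segStart_nonneg hx k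
  have h3 := segEnd_le hx k
  constructor <;> rw [segMid] <;> linarith

theorem time_lt_segMid_iff {i : Fin n} {k : Fin (n + 1)} :
    (x i).2 < segMid b x k ↔ i.castSucc < k := by
  refine ⟨fun h => ?_, fun h => (time_le_segStart hx h).trans_lt (segStart_lt_segMid hx i k)⟩
  by_contra hk
  exact lt_asymm h ((segMid_lt_segEnd hx i k).trans_le (segEnd_le_time hx (not_lt.1 hk)))

theorem segMid_lt_time_iff {i : Fin n} {k : Fin (n + 1)} :
    segMid b x k < (x i).2 ↔ k ≤ i.castSucc := by
  refine ⟨fun h => ?_, fun h => (segMid_lt_segEnd hx i k).trans_le (segEnd_le_time hx h)⟩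
  by_contra hk
  exact lt_asymm h ((time_lt_segMid_iff hx).2 (not_le.1 hk))

theorem time_ne_segMid (i : Fin n) (k : Fin (n + 1)) : (x i).2 ≠ segMid b x k := by
  rcases lt_or_ge i.castSucc k with h | h
  · exact ((time_lt_segMid_iff hx).2 h).ne
  · exact ((segMid_lt_time_iff hx).2 h).ne'

theorem segOf_segMid (k : Fin (n + 1)) : segOf x (segMid b x k) = k :=
  segOf_eq hx fun _ => time_lt_segMid_iff hx

theorem segOf_of_mem_Ioo {k : Fin (n + 1)} {s : ℝ} (hs : s ∈ Set.Ioo (segStart x k) (segEnd b x k)) :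
    segOf x s = k := by
  refine segOf_eq hx fun i => ⟨fun h => ?_, fun h => (time_le_segStart hx h).trans_lt hs.1⟩
  by_contra hk
  exact lt_asymm h (hs.2.trans_le (segEnd_le_time hx (not_lt.1 hk)))

theorem segStart_segOf_le {s : ℝ} (hs : 0 ≤ s) : segStart x (segOf x s) ≤ s := by
  rcases Fin.eq_zero_or_eq_succ (segOf x s) with h | ⟨j, h⟩
  · rw [h]; exact hs
  · rw [h, segStart_succ]
    exact ((time_lt_iff hx).2 (h ▸ Fin.castSucc_lt_succ)).le

theorem le_segEnd_segOf {s : ℝ} (hs : s ≤ b) : s ≤ segEnd b x (segOf x s) := by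
  rcases Fin.eq_castSucc_or_eq_last (segOf x s) with ⟨j, h⟩ | h
  · rw [h, segEnd_castSucc]
    exact not_lt.1 fun hlt => absurd ((time_lt_iff hx).1 hlt) (h ▸ lt_irrefl _)
  · rw [h, segEnd_last]; exact hs

theorem disjoint_Ioo_seg {k l : Fin (n + 1)} (h : k ≠ l) :
    Disjoint (Set.Ioo (segStart x k) (segEnd b x k)) (Set.Ioo (segStart x l) (segEnd b x l)) := by
  refine Set.disjoint_left.2 fun s h1 h2 => h ?_
  rw [← segOf_of_mem_Ioo hx h1, segOf_of_mem_Ioo hx h2]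

end Segments

/-! ### Correspondence between functions on loops and compatible spin paths. -/

section Loops

variable {V : Type*} {G : SimpleGraph V} {S : Type*}

/-- The spins `τ` just before and `σ` just after an event with the mark `m` are compatible. -/
def Mark.Allows (m : Mark G) (σ τ : V → S) : Prop :=
  (∀ z ∉ (m.edge : Sym2 V), σ z = τ z) ∧ ∀ y z, s(y, z) = (m.edge : Sym2 V) →
    match m.kind with
    | Kind.cross => σ z = τ y
    | Kind.doubleBar => σ y = σ z ∧ τ y = τ z

/-- The time-periodic sequences of spin configurations compatible with all events. -/
def spinPaths (S : Type*) {n : ℕ} (x : Fin n → Event G) : Set (Fin (n + 1) → V → S) :=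
  {σ | σ (Fin.last n) = σ 0 ∧ ∀ i, (x i).1.Allows (σ i.succ) (σ i.castSucc)}

variable {n : ℕ} {β : ℝ} {x : Fin n → Event G}

/-- Events are crossed one at a time, and an event away from `z` leaves the spin at `z` unchanged.
-/
theorem apply_eq_of_forall_notMem {σ : Fin (n + 1) → V → S} (hσ : σ ∈ spinPaths S x) (z : V)
    (j k : Fin (n + 1)) (hjk : j ≤ k)
    (h : ∀ i : Fin n, j ≤ i.castSucc → i.castSucc < k → z ∉ ((x i).1.edge : Sym2 V)) :
    σ j z = σ k z := by
  induction k using Fin.induction with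
  | zero => rw [Fin.le_zero_iff.1 hjk]
  | succ i ih =>
    rcases hjk.eq_or_lt with rfl | hlt
    · rfl
    · have hji := Fin.le_castSucc_iff.2 hlt
      rw [ih hji fun i' h1 h2 => h i' h1 (h2.trans Fin.castSucc_lt_succ),
        (hσ.2 i).1 z (h i hji Fin.castSucc_lt_succ)]

variable (hx : x ∈ orderedTuples (Mark G) n β)
include hx

/-- Freeness at `s` itself matters: `segOf` places an event at time `s` after `s`. -/
theorem spin_segOf_eq_before {σ : Fin (n + 1) → V → S} (hσ : σ ∈ spinPaths S x) {z : V} {i : Fin n}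
    {s : ℝ} (hs : s < (x i).2) (hf : IsFree (toConfig n x) z (Set.Ico s (x i).2)) :
    σ (segOf x s) z = σ i.castSucc z := by
  have hle : segOf x s ≤ i.castSucc := not_lt.1 fun h => lt_asymm hs ((time_lt_iff hx).2 h)
  refine apply_eq_of_forall_notMem hσ z _ _ hle fun j h1 h2 hz =>
    hf _ (mem_toConfig.2 ⟨j, rfl⟩) hz ⟨?_, hx.1 (Fin.castSucc_lt_castSucc_iff.1 h2)⟩
  exact not_lt.1 fun h => absurd ((time_lt_iff hx).1 h) (not_lt.2 h1)

theorem spin_segOf_eq_after {σ : Fin (n + 1) → V → S} (hσ : σ ∈ spinPaths S x) {z : V} {i : Fin n}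
    {t : ℝ} (ht : (x i).2 < t) (hf : IsFree (toConfig n x) z (Set.Ioc (x i).2 t)) :
    σ (segOf x t) z = σ i.succ z := by
  refine (apply_eq_of_forall_notMem hσ z _ _ (Fin.castSucc_lt_iff_succ_le.1
    ((time_lt_iff hx).1 ht)) fun j h1 h2 hz => hf _ (mem_toConfig.2 ⟨j, rfl⟩) hz
      ⟨hx.1 ?_, ((time_lt_iff hx).2 h2).le⟩).symm
  exact Fin.castSucc_lt_castSucc_iff.1 (Fin.castSucc_lt_succ.trans_le h1)

/-- Each generating connection preserves the spin, so a compatible path descends to the quotient by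
loops. -/
theorem spin_segOf_eq_of_connected {σ : Fin (n + 1) → V → S} (hσ : σ ∈ spinPaths S x)
    {p q : V × ℝ} (hpq : Connected β (toConfig n x) p q) :
    σ (segOf x p.2) p.1 = σ (segOf x q.2) q.1 := by
  cases hpq with
  | vertical z s t hst hf =>
    have hle : segOf x s ≤ segOf x t := by
      by_contra h
      rw [not_le] at h
      obtain ⟨j, hj⟩ := Fin.exists_castSucc_eq.2 (h.trans_le (Fin.le_last _)).ne
      exact absurd ((time_lt_iff hx).1 (((time_lt_iff hx).2 (hj ▸ h)).trans_le hst))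
        (hj ▸ lt_irrefl _)
    refine apply_eq_of_forall_notMem hσ z _ _ hle fun i h1 h2 hz =>
      hf _ (mem_toConfig.2 ⟨i, rfl⟩) hz ⟨?_, ((time_lt_iff hx).2 h2).le⟩
    exact not_lt.1 fun h => absurd ((time_lt_iff hx).1 h) (not_lt.2 h1)
  | periodic z =>
    simp only [segOf_zero hx, segOf_end hx, hσ.1]
  | cross y z hyz τ s t hω hs ht hy hz =>
    obtain ⟨i, hi⟩ := mem_toConfig.1 hω
    obtain rfl : (x i).2 = τ := by rw [hi]
    have h := (hσ.2 i).2 y z (by rw [hi])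
    rw [show (x i).1.kind = Kind.cross by rw [hi]] at h
    simp only at h ⊢
    rw [spin_segOf_eq_before hx hσ hs hy, spin_segOf_eq_after hx hσ ht hz, h]
  | below y z hyz τ s t hω hs ht hy hz =>
    obtain ⟨i, hi⟩ := mem_toConfig.1 hω
    obtain rfl : (x i).2 = τ := by rw [hi]
    have h := (hσ.2 i).2 y z (by rw [hi])
    rw [show (x i).1.kind = Kind.doubleBar by rw [hi]] at h
    simp only at h ⊢
    rw [spin_segOf_eq_before hx hσ hs hy, spin_segOf_eq_before hx hσ ht hz, h.2]
  | above y z hyz τ s t hω hs ht hy hz =>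
    obtain ⟨i, hi⟩ := mem_toConfig.1 hω
    obtain rfl : (x i).2 = τ := by rw [hi]
    have h := (hσ.2 i).2 y z (by rw [hi])
    rw [show (x i).1.kind = Kind.doubleBar by rw [hi]] at h
    simp only at h ⊢
    rw [spin_segOf_eq_after hx hσ hs hy, spin_segOf_eq_after hx hσ ht hz, h.1]

theorem isFree_segMid (k : Fin (n + 1)) (z : V) :
    IsFree (toConfig n x) z {segMid β x k} := by
  intro e he _ h
  obtain ⟨i, rfl⟩ := mem_toConfig.1 he
  exact time_ne_segMid hx i k h

variable (hβ : 0 ≤ β)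
include hβ

/-- The loop through the site `z` during the `k`-th time interval. -/
noncomputable def segLoop (k : Fin (n + 1)) (z : V) : Loop β (toConfig n x) :=
  Quotient.mk (loopSetoid β (toConfig n x))
    ⟨(z, segMid β x k), segMid_mem_Icc hx hβ k, isFree_segMid hx k z⟩

omit hx hβ in
theorem loop_mk_eq_of_connected {ω : Multiset (Event G)} {p q : RegularPoint β ω}
    (h : Connected β ω p.1 q.1) :
    Quotient.mk (loopSetoid β ω) p = Quotient.mk (loopSetoid β ω) q :=
  Quotient.sound (Relation.EqvGen.rel _ _ h)

/-- A vertical line joins the point to the midpoint of its interval. A regular point may share its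
time with an event at an edge avoiding its site; such an event does not obstruct the line. -/
theorem loop_mk_eq_segLoop (p : RegularPoint β (toConfig n x)) :
    Quotient.mk (loopSetoid β (toConfig n x)) p = segLoop hx hβ (segOf x p.1.2) p.1.1 := by
  obtain ⟨⟨z, s⟩, hs, hf⟩ := p
  have hne : ∀ i, z ∈ ((x i).1.edge : Sym2 V) → (x i).2 ≠ s := fun i hz =>
    hf _ (mem_toConfig.2 ⟨i, rfl⟩) hz
  simp only at hs ⊢
  rcases le_total s (segMid β x (segOf x s)) with h | h
  · refine loop_mk_eq_of_connected (Connected.vertical z s _ h fun e he hz hmem => ?_)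
    obtain ⟨i, rfl⟩ := mem_toConfig.1 he
    have h1 := (hne i hz).symm.lt_of_le hmem.1
    have h2 : segOf x s ≤ i.castSucc := not_lt.1 fun h => lt_asymm h1 ((time_lt_iff hx).2 h)
    exact not_lt.2 hmem.2 ((segMid_lt_time_iff hx).2 h2)
  · refine (loop_mk_eq_of_connected (Connected.vertical z _ s h fun e he hz hmem => ?_)).symm
    obtain ⟨i, rfl⟩ := mem_toConfig.1 he
    have h1 := (hne i hz).lt_of_le hmem.2
    exact not_lt.2 hmem.1 ((time_lt_segMid_iff hx).2 ((time_lt_iff hx).1 h1))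

theorem segLoop_surjective :
    Function.Surjective fun p : Fin (n + 1) × V => segLoop hx hβ p.1 p.2 := by
  intro γ
  induction γ using Quotient.inductionOn with
  | h p => exact ⟨(segOf x p.1.2, p.1.1), (loop_mk_eq_segLoop hx hβ p).symm⟩

/-- Time periodicity comes from the periodic connection, constancy off an event's edge from a
vertical line past it, and compatibility on the edge from the cross or double bar. -/
theorem comp_segLoop_mem_spinPaths (f : Loop β (toConfig n x) → S) :
    (fun k z => f (segLoop hx hβ k z)) ∈ spinPaths S x := by
  refine ⟨funext fun z => congrArg f ?_, fun i => ⟨fun z hz => congrArg f ?_,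
    fun y z hyz => ?_⟩⟩
  · have h0 : IsFree (toConfig n x) z {(0 : ℝ)} := by
      intro e he _ h
      obtain ⟨i, rfl⟩ := mem_toConfig.1 he
      exact (hx.2 i).1.ne' h
    have hb : IsFree (toConfig n x) z {β} := by
      intro e he _ h
      obtain ⟨i, rfl⟩ := mem_toConfig.1 he
      exact (hx.2 i).2.ne h
    have h1 := loop_mk_eq_segLoop hx hβ ⟨(z, 0), ⟨le_rfl, hβ⟩, h0⟩
    have h2 := loop_mk_eq_segLoop hx hβ ⟨(z, β), ⟨hβ, le_rfl⟩, hb⟩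
    simp only [segOf_zero hx, segOf_end hx] at h1 h2
    rw [← h1, ← h2]
    exact (loop_mk_eq_of_connected (Connected.periodic z)).symm
  · have h1 : segMid β x i.castSucc < (x i).2 := (segMid_lt_time_iff hx).2 le_rfl
    have h2 : (x i).2 < segMid β x i.succ := (time_lt_segMid_iff hx).2 Fin.castSucc_lt_succ
    refine (loop_mk_eq_of_connected
      (Connected.vertical z _ _ (h1.trans h2).le fun e he hze hmem => ?_)).symm
    obtain ⟨j, rfl⟩ := mem_toConfig.1 he
    have h3 : i.castSucc ≤ j.castSucc :=
      not_lt.1 fun h => absurd ((time_lt_segMid_iff hx).2 h) (not_lt.2 hmem.1)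
    have h4 : j.castSucc < i.succ :=
      not_le.1 fun h => absurd ((segMid_lt_time_iff hx).2 h) (not_lt.2 hmem.2)
    -- Only event `i` lies between the midpoints of two neighbouring intervals.
    obtain rfl : j = i := le_antisymm (Fin.castSucc_lt_succ_iff.1 h4)
      (Fin.castSucc_le_castSucc_iff.1 h3)
    exact hz hze
  · have h1 : segMid β x i.castSucc < (x i).2 := (segMid_lt_time_iff hx).2 le_rfl
    have h2 : (x i).2 < segMid β x i.succ := (time_lt_segMid_iff hx).2 Fin.castSucc_lt_succ
    have hbefore : ∀ z, IsFree (toConfig n x) z (Set.Ico (segMid β x i.castSucc) (x i).2) := by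
      intro z e he _ hmem
      obtain ⟨j, rfl⟩ := mem_toConfig.1 he
      exact not_lt.2 hmem.1 ((time_lt_segMid_iff hx).2
        (Fin.castSucc_lt_castSucc_iff.2 (hx.1.lt_iff_lt.1 hmem.2)))
    have hafter : ∀ z, IsFree (toConfig n x) z (Set.Ioc (x i).2 (segMid β x i.succ)) := by
      intro z e he _ hmem
      obtain ⟨j, rfl⟩ := mem_toConfig.1 he
      exact not_lt.2 hmem.2 ((segMid_lt_time_iff hx).2
        (Fin.succ_le_castSucc_iff.2 (hx.1.lt_iff_lt.1 hmem.1)))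
    have hmem : x i ∈ toConfig n x := mem_toConfig.2 ⟨i, rfl⟩
    have hedge : s(y, z) ∈ G.edgeSet := hyz ▸ (x i).1.edge.2
    obtain ⟨⟨⟨e, k⟩, τ⟩, hxi⟩ : ∃ ev, x i = ev := ⟨_, rfl⟩
    obtain rfl : e = ⟨s(y, z), hedge⟩ := Subtype.ext (by simp only [hyz, hxi])
    rw [hxi] at h1 h2 hbefore hafter hmem
    simp only [hxi]
    cases k with
    | cross =>
      exact congrArg f (loop_mk_eq_of_connected
        (Connected.cross y z hedge τ _ _ hmem h1 h2 (hbefore y) (hafter z))).symm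
    | doubleBar =>
      exact ⟨congrArg f (loop_mk_eq_of_connected
          (Connected.above y z hedge τ _ _ hmem h2 h2 (hafter y) (hafter z))),
        congrArg f (loop_mk_eq_of_connected
          (Connected.below y z hedge τ _ _ hmem h1 h1 (hbefore y) (hbefore z)))⟩

/-- Functions on the set of loops are the same as compatible periodic sequences of spin
configurations. -/
noncomputable def loopFunEquiv : (Loop β (toConfig n x) → S) ≃ spinPaths S x where
  toFun f := ⟨fun k z => f (segLoop hx hβ k z), comp_segLoop_mem_spinPaths hx hβ f⟩
  invFun σ := Quotient.lift (fun p : RegularPoint β (toConfig n x) =>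
      (σ : Fin (n + 1) → V → S) (segOf x p.1.2) p.1.1) fun p q hpq => by
    induction hpq with
    | rel p q h => exact spin_segOf_eq_of_connected hx σ.2 h
    | refl p => rfl
    | symm p q _ ih => exact ih.symm
    | trans p q r _ _ ih1 ih2 => exact ih1.trans ih2
  left_inv f := by
    funext γ
    induction γ using Quotient.inductionOn with
    | h p => exact congrArg f (loop_mk_eq_segLoop hx hβ p).symm
  right_inv σ := by
    refine Subtype.ext (funext fun k => funext fun z => ?_)
    show (σ : Fin (n + 1) → V → S) (segOf x (segMid β x k)) z = _
    rw [segOf_segMid hx]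

/-- Up to finitely many endpoints, the times at which `γ` visits `z` form the disjoint union of the
open intervals assigned to `γ`. -/
theorem loopLength_eq [DecidableEq (Loop β (toConfig n x))] (γ : Loop β (toConfig n x)) (z : V) :
    loopLength γ z = ∑ k : Fin (n + 1),
      if segLoop hx hβ k z = γ then segEnd β x k - segStart x k else 0 := by
  set K := Finset.univ.filter fun k => segLoop hx hβ k z = γ with hK
  set U := ⋃ k ∈ K, Set.Ioo (segStart x k) (segEnd β x k) with hU
  have hae : ({t : ℝ | ∃ p : RegularPoint β (toConfig n x), p.1 = (z, t) ∧
      Quotient.mk (loopSetoid β (toConfig n x)) p = γ} : Set ℝ) =ᵐ[volume] U := by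
    refine ae_eq_set.2 ⟨?_, ?_⟩
    · refine Set.Finite.measure_zero (Set.Finite.subset
        ((Set.finite_range (segStart x)).union (Set.finite_range (segEnd β x))) ?_) _
      rintro t ⟨⟨p, hp, hpγ⟩, ht⟩
      obtain ⟨⟨z', t'⟩, hs, hf⟩ := p
      obtain ⟨rfl, rfl⟩ := Prod.mk.inj hp
      replace hpγ : segLoop hx hβ (segOf x t') z' = γ :=
        (loop_mk_eq_segLoop hx hβ _).symm.trans hpγ
      by_contra hmem
      simp only [Set.mem_union, Set.mem_range, not_or, not_exists] at hmem
      refine ht (Set.mem_biUnion (x := segOf x t') (by simpa [hK] using hpγ) ⟨?_, ?_⟩)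
      · exact (segStart_segOf_le hx hs.1).lt_of_ne (hmem.1 _)
      · exact (le_segEnd_segOf hx hs.2).lt_of_ne' (hmem.2 _)
    · rw [Set.sdiff_eq_empty.2, measure_empty]
      intro t ht
      obtain ⟨k, hk, ht⟩ := Set.mem_iUnion₂.1 ht
      have hkγ : segLoop hx hβ k z = γ := by simpa [hK] using hk
      have hfree : IsFree (toConfig n x) z {t} := by
        intro e he _ h
        obtain ⟨i, rfl⟩ := mem_toConfig.1 he
        obtain rfl : (x i).2 = t := h
        rcases lt_or_ge i.castSucc k with h | h
        · exact not_lt.2 (time_le_segStart hx h) ht.1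
        · exact not_lt.2 (segEnd_le_time hx h) ht.2
      refine ⟨⟨(z, t), ⟨(segStart_nonneg hx k).trans ht.1.le, ht.2.le.trans (segEnd_le hx k)⟩,
        hfree⟩, rfl, (loop_mk_eq_segLoop hx hβ _).trans ?_⟩
      exact (congrArg (fun k => segLoop hx hβ k z) (segOf_of_mem_Ioo hx ht)).trans hkγ
  rw [loopLength, measureReal_congr hae, hU, measureReal_biUnion_finset
    (fun k _ l _ hkl => disjoint_Ioo_seg hx hkl) (fun _ _ => measurableSet_Ioo) (fun _ _ => measure_Ioo_lt_top.ne), hK,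
    Finset.sum_filter]
  refine Finset.sum_congr rfl fun k _ => ?_
  rw [Real.volume_real_Ioo_of_le (segStart_le_segEnd hx hβ k)]

/-- The energy of a configuration in the external field. -/
noncomputable def fieldEnergy {V : Type*} [Fintype V] (N : ℕ) (h : V → ℝ) (σ : V → Fin (N + 1)) : ℝ :=
  ∑ z, h z * spin N (σ z)

open Classical in
/-- The product of the loop weights is a sum over compatible periodic sequences of spin
configurations. -/
theorem finprod_loopWeight [Fintype V] [DecidableEq V] (N : ℕ) (h : V → ℝ) :
    ∏ᶠ γ : Loop β (toConfig n x), loopWeight N h γ =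
      ∑ σ : Fin (n + 1) → V → Fin (N + 1), if σ ∈ spinPaths (Fin (N + 1)) x then
        Real.exp (∑ k, (segEnd β x k - segStart x k) * fieldEnergy N h (σ k)) else 0 := by
  have : Finite (Loop β (toConfig n x)) := Finite.of_surjective _ (segLoop_surjective hx hβ)
  have := Fintype.ofFinite (Loop β (toConfig n x))
  rw [finprod_eq_prod_of_fintype]
  simp only [loopWeight]
  -- Distributing the product over the sums gives a sum over functions from loops to spins, which
  -- `loopFunEquiv` reindexes by paths.
  rw [Finset.prod_univ_sum, Fintype.piFinset_univ, ← Finset.sum_filter,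
    Finset.sum_subtype (p := (· ∈ spinPaths (Fin (N + 1)) x)) _ (by simp)]
  refine Fintype.sum_equiv (loopFunEquiv hx hβ) _ _ fun f => ?_
  rw [← Real.exp_sum]
  congr 1
  show _ = ∑ k, (segEnd β x k - segStart x k) * ∑ z, h z * spin N (f (segLoop hx hβ k z))
  simp only [loopLength_eq hx hβ, Finset.mul_sum]
  rw [Finset.sum_comm]
  conv_lhs => enter [2, z]; rw [Finset.sum_comm]
  rw [Finset.sum_comm]
  refine Finset.sum_congr rfl fun k _ => Finset.sum_congr rfl fun z _ => ?_
  simp only [mul_ite, mul_zero]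
  -- For each interval and site, exactly one loop passes through.
  rw [Finset.sum_ite_eq]
  simp only [Finset.mem_univ, if_true]
  ring

end Loops

/-! ### Expansion of the trace -/

section Trace

/-- The sum over intermediate indices in the matrix product; time runs from right to left, so the
row index is the final state. -/
theorem orderedProd_apply {M ι R : Type*} [Fintype ι] [DecidableEq ι] [CommSemiring R]
    (C : M × ℝ → Matrix ι ι R) (n : ℕ) (x : Fin n → M × ℝ) (a c : ι) :
    orderedProd C n x a c = ∑ σ : Fin (n + 1) → ι, if σ (Fin.last n) = a ∧ σ 0 = c then
      ∏ i : Fin n, C (x i) (σ i.succ) (σ i.castSucc) else 0 := by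
  induction n generalizing a with
  | zero =>
    rw [Fintype.sum_equiv (Equiv.funUnique (Fin 1) ι) _
      (fun d => if d = a ∧ d = c then (1 : R) else 0) (fun σ => by simp)]
    simp [orderedProd, Matrix.one_apply, ite_and]
  | succ n ih =>
    rw [orderedProd, Matrix.mul_apply, ← (Fin.snocEquiv fun _ : Fin (n + 2) => ι).sum_comp,
      Fintype.sum_prod_type]
    simp only [Fin.snocEquiv_apply, Fin.snoc_last, Fin.prod_univ_castSucc, Fin.succ_last,
      Fin.snoc_castSucc, ih, Finset.mul_sum]
    have h0 : ∀ (d : ι) (σ : Fin (n + 1) → ι),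
        (Fin.snoc (α := fun _ => ι) σ d : Fin (n + 2) → ι) 0 = σ 0 := fun d σ =>
      Fin.snoc_castSucc (α := fun _ => ι) d σ 0
    have h1 : ∀ (d : ι) (σ : Fin (n + 1) → ι) (i : Fin n),
        (Fin.snoc (α := fun _ => ι) σ d : Fin (n + 2) → ι) i.castSucc.succ = σ i.succ :=
      fun d σ i => Fin.snoc_castSucc (α := fun _ => ι) d σ i.succ
    simp only [h0, h1]
    conv_rhs => rw [Finset.sum_eq_single a (fun d _ hd => by simp [hd]) (by simp)]
    rw [Finset.sum_comm]
    refine Finset.sum_congr rfl fun σ _ => ?_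
    -- The index summed in the outer multiplication must be the final state of the shorter path.
    rw [Finset.sum_eq_single (σ (Fin.last n)) (fun d _ hd => by simp [hd.symm]) (by simp)]
    by_cases h : σ 0 = c <;> simp [h, mul_comm]

variable {V : Type*} [Fintype V] [DecidableEq V] {G : SimpleGraph V}

open Classical in
/-- The operator attached to a cross or a double bar. -/
noncomputable def markOp (N : ℕ) (m : Mark G) : Op V N :=
  Matrix.of fun σ τ => if m.Allows σ τ then 1 else 0

omit [DecidableEq V] in
theorem sum_smul_spinZ (N : ℕ) (h : V → ℝ) :
    ∑ z, (h z : ℂ) • spinZ N z = Matrix.diagonal fun σ => (fieldEnergy N h σ : ℂ) := by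
  ext σ τ
  rw [Matrix.sum_apply]
  by_cases hστ : σ = τ
  · subst hστ
    simp [spinZ, fieldEnergy]
  · simp [spinZ, Matrix.diagonal_apply_ne _ hστ]

/-- `Allows` ranges over both orderings of the edge; once one is fixed, it reduces to the Kronecker
deltas of `T` and `Q` together with equality off the edge. -/
theorem edgeBond_eq (N : ℕ) (u : ℝ) (e : G.edgeSet) :
    edgeBond N u (e : Sym2 V) =
      (u : ℂ) • markOp N (⟨e, Kind.cross⟩ : Mark G) +
        ((1 - u : ℝ) : ℂ) • markOp N (⟨e, Kind.doubleBar⟩ : Mark G) - 1 := by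
  obtain ⟨e, he⟩ := e
  induction e using Sym2.inductionOn with
  | hf y z =>
    ext σ τ
    have hout : (∀ w ∉ s(y, z), σ w = τ w) ↔ ∀ w, w ≠ y → w ≠ z → σ w = τ w := by
      simp only [Sym2.mem_iff, not_or, and_imp]
    have hc : (⟨⟨s(y, z), he⟩, Kind.cross⟩ : Mark G).Allows σ τ ↔
        (∀ w, w ≠ y → w ≠ z → σ w = τ w) ∧ σ y = τ z ∧ σ z = τ y := by
      refine and_congr hout ⟨fun h => ⟨h z y Sym2.eq_swap, h y z rfl⟩, fun h a b hab => ?_⟩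
      rcases Sym2.eq_iff.1 hab with ⟨rfl, rfl⟩ | ⟨rfl, rfl⟩
      exacts [h.2, h.1]
    have hd : (⟨⟨s(y, z), he⟩, Kind.doubleBar⟩ : Mark G).Allows σ τ ↔
        (∀ w, w ≠ y → w ≠ z → σ w = τ w) ∧ σ y = σ z ∧ τ y = τ z := by
      refine and_congr hout ⟨fun h => h y z rfl, fun h a b hab => ?_⟩
      rcases Sym2.eq_iff.1 hab with ⟨rfl, rfl⟩ | ⟨rfl, rfl⟩
      exacts [h, ⟨h.1.symm, h.2.symm⟩]
    have h1 : σ = τ ↔ (∀ w, w ≠ y → w ≠ z → σ w = τ w) ∧ σ y = τ y ∧ σ z = τ z := by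
      refine ⟨fun h => by simp [h], fun h => funext fun w => ?_⟩
      by_cases hy : w = y
      · rw [hy, h.2.1]
      by_cases hz : w = z
      · rw [hz, h.2.2]
      exact h.1 w hy hz
    simp only [edgeBond, Sym2.lift_mk, extendOp, bond, T, Q, markOp, Matrix.of_apply,
      Matrix.sub_apply, Matrix.add_apply, Matrix.smul_apply, Matrix.one_apply, hc, hd, h1,
      Prod.mk.injEq]
    by_cases hw : ∀ w, w ≠ y → w ≠ z → σ w = τ w
    · simp only [eq_true hw, true_and, if_true]
    · simp only [eq_false hw, false_and, if_false]
      simp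

theorem exp_smul_diagonal {ι : Type*} [Fintype ι] [DecidableEq ι] (d : ι → ℝ) (s : ℝ) :
    NormedSpace.exp (s • Matrix.diagonal fun a => (d a : ℂ)) =
      Matrix.diagonal fun a => ((Real.exp (s * d a) : ℝ) : ℂ) := by
  rw [← Matrix.diagonal_smul, Matrix.exp_diagonal]
  congr 1
  funext a
  rw [Pi.coe_exp, Complex.ofReal_exp, Complex.exp_eq_exp_ℂ]
  simp

open Classical in
/-- The trace of `e^{bD}` times a time-ordered product of event operators is a sum over compatible
periodic sequences of spin configurations. -/
theorem trace_exp_mul_orderedProd (N : ℕ) (h : V → ℝ) (b : ℝ) {C : Event G → Op V N}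
    (hC : ∀ y, C y = (Matrix.diagonal fun σ => ((Real.exp (-y.2 * fieldEnergy N h σ) : ℝ) : ℂ)) *
      markOp N y.1 * Matrix.diagonal fun σ => ((Real.exp (y.2 * fieldEnergy N h σ) : ℝ) : ℂ))
    (n : ℕ) (x : Fin n → Event G) :
    ((Matrix.diagonal fun σ => ((Real.exp (b * fieldEnergy N h σ) : ℝ) : ℂ)) *
        orderedProd C n x).trace =
      ((∑ σ : Fin (n + 1) → V → Fin (N + 1), if σ ∈ spinPaths (Fin (N + 1)) x then
        Real.exp (∑ k, (segEnd b x k - segStart x k) * fieldEnergy N h (σ k)) else 0 : ℝ) : ℂ) := by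
  rw [Matrix.trace]
  simp only [Matrix.diag_apply, Matrix.diagonal_mul, orderedProd_apply, hC, Matrix.mul_diagonal,
    Finset.mul_sum]
  rw [Finset.sum_comm, Complex.ofReal_sum]
  refine Finset.sum_congr rfl fun σ _ => ?_
  rw [Finset.sum_eq_single (σ (Fin.last n)) (fun a _ ha => by simp [ha.symm]) (by simp)]
  have hmem : σ ∈ spinPaths (Fin (N + 1)) x ↔
      σ 0 = σ (Fin.last n) ∧ ∀ i ∈ Finset.univ, (x i).1.Allows (σ i.succ) (σ i.castSucc) := by
    simp only [spinPaths, Set.mem_ofPred_eq, Finset.mem_univ, true_imp_iff, eq_comm]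
  -- Summation by parts: each configuration gains its energy times the final time of its interval
  -- and loses it times the initial time. The leading `e^{bD}` supplies the last final time.
  have hexp : Real.exp (∑ k, (segEnd b x k - segStart x k) * fieldEnergy N h (σ k)) =
      Real.exp (b * fieldEnergy N h (σ (Fin.last n))) *
        ∏ i : Fin n, (Real.exp (-(x i).2 * fieldEnergy N h (σ i.succ)) *
          Real.exp ((x i).2 * fieldEnergy N h (σ i.castSucc))) := by
    simp only [← Real.exp_add, ← Real.exp_sum]
    congr 1
    simp only [sub_mul, Finset.sum_sub_distrib, neg_mul, Finset.sum_add_distrib,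
      Finset.sum_neg_distrib]
    rw [Fin.sum_univ_castSucc, Fin.sum_univ_succ (f := fun k => segStart x k * _)]
    simp only [segEnd_castSucc, segEnd_last, segStart_succ, segStart_zero]
    ring
  simp only [hmem, true_and]
  by_cases h0 : σ 0 = σ (Fin.last n)
  · simp only [h0, if_true, true_and]
    by_cases hall : ∀ i ∈ Finset.univ, (x i).1.Allows (σ i.succ) (σ i.castSucc)
    · rw [if_pos hall, hexp]
      push_cast
      congr 1
      refine Finset.prod_congr rfl fun i hi => ?_
      simp [markOp, hall i hi]
    · rw [if_neg hall]
      push Not at hall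
      obtain ⟨i, hi, hni⟩ := hall
      rw [Finset.prod_eq_zero hi (by simp [markOp, hni]), mul_zero, Complex.ofReal_zero]
  · simp [h0]

end Trace

/-! ### The loop representation of the partition function -/

section Representation

open scoped Matrix.Norms.L2Operator

variable {V : Type*} [Fintype V] [DecidableEq V] (G : SimpleGraph V)

/-- The intensity measure of the marks. -/
noncomputable def markIntensity [Fintype G.edgeSet] (u : ℝ) : Measure (Mark G) :=
  ∑ e : G.edgeSet,
    (ENNReal.ofReal u • Measure.dirac (⟨e, Kind.cross⟩ : Mark G) +
      ENNReal.ofReal (1 - u) • Measure.dirac (⟨e, Kind.doubleBar⟩ : Mark G))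

instance [Fintype G.edgeSet] (u : ℝ) : IsFiniteMeasure (markIntensity G u) := by
  refine ⟨?_⟩
  rw [markIntensity, Measure.finsetSum_apply _ _ _]
  refine ENNReal.sum_lt_top.2 fun e _ => ?_
  simp [ENNReal.add_lt_top]

omit [Fintype V] [DecidableEq V] in
theorem intensity_eq [Fintype G.edgeSet] (u β : ℝ) :
    intensity G u β = (markIntensity G u).prod (volume.restrict (Set.Icc 0 β)) := by
  rw [intensity, markIntensity, ← Measure.sum_fintype, ← Measure.sum_fintype,
    Measure.prod_sum_left]

-- Each edge carries mass `u + (1 - u) = 1`; `u ∈ [0, 1]` keeps `ENNReal.ofReal` from truncating.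
omit [Fintype V] [DecidableEq V] in
theorem intensity_real_univ [Fintype G.edgeSet] {u β : ℝ} (hu : u ∈ Set.Icc (0 : ℝ) 1)
    (hβ : 0 ≤ β) :
    ((markIntensity G u).prod (volume.restrict (Set.Icc 0 β))).real Set.univ =
      Fintype.card G.edgeSet * β := by
  have h1 : (markIntensity G u) Set.univ = Fintype.card G.edgeSet := by
    rw [markIntensity, Measure.finsetSum_apply _ _ _]
    simp only [Measure.add_apply, Measure.smul_apply, measure_univ, smul_eq_mul, mul_one]
    rw [← ENNReal.ofReal_add hu.1 (sub_nonneg.2 hu.2)]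
    simp
  rw [Measure.real, ← Set.univ_prod_univ, Measure.prod_prod, h1]
  simp [hβ]

/-- The sum over the edges of `u T + (1 - u) Q`. -/
theorem integral_markOp [Fintype G.edgeSet] (N : ℕ) {u : ℝ} (hu : u ∈ Set.Icc (0 : ℝ) 1) :
    ∫ m, markOp N m ∂(markIntensity G u) =
      ∑ e : G.edgeSet, ((u : ℂ) • markOp N (⟨e, Kind.cross⟩ : Mark G) +
        ((1 - u : ℝ) : ℂ) • markOp N (⟨e, Kind.doubleBar⟩ : Mark G)) := by
  have hi : ∀ (m : Mark G) (c : ℝ),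
      Integrable (markOp (G := G) N) (ENNReal.ofReal c • Measure.dirac m) := fun m c =>
    (integrable_dirac (by simp)).smul_measure ENNReal.ofReal_ne_top
  rw [markIntensity, integral_finsetSum_measure fun e _ => (hi _ _).add_measure (hi _ _)]
  refine Finset.sum_congr rfl fun e _ => ?_
  rw [integral_add_measure (hi _ _) (hi _ _), integral_smul_measure, integral_smul_measure,
    integral_dirac, integral_dirac, ENNReal.toReal_ofReal hu.1,
    ENNReal.toReal_ofReal (sub_nonneg.2 hu.2)]
  rfl

/-- The scalar part is isolated because its exponential is the Poisson normalization `e^{-μ(X)}`. -/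
theorem neg_smul_hamiltonian [DecidableRel G.Adj] (N : ℕ) {u : ℝ} (hu : u ∈ Set.Icc (0 : ℝ) 1)
    (β : ℝ) (h : V → ℝ) :
    -((β : ℂ) • hamiltonian G N u h) =
      β • ((Matrix.diagonal fun σ => (fieldEnergy N h σ : ℂ)) +
          ∫ m, markOp N m ∂(markIntensity G u)) +
        (-(Fintype.card G.edgeSet * β)) • (1 : Op V N) := by
  have h1 : ∑ e ∈ G.edgeFinset, edgeBond N u e =
      (∫ m, markOp N m ∂(markIntensity G u)) - (Fintype.card G.edgeSet : ℝ) • (1 : Op V N) := by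
    rw [integral_markOp G N hu, SimpleGraph.edgeFinset, ← Finset.sum_set_coe]
    simp only [edgeBond_eq, Finset.sum_sub_distrib, Finset.sum_const, Finset.card_univ,
      Nat.cast_smul_eq_nsmul]
  rw [hamiltonian, h1, sum_smul_spinZ, Complex.coe_smul]
  module

omit [DecidableEq V] in
theorem finprod_loopWeight_zero {G : SimpleGraph V} (N : ℕ) {β : ℝ} (ω : Multiset (Event G)) :
    ∏ᶠ γ : Loop β ω, loopWeight N (fun _ => 0) γ = ((N : ℝ) + 1) ^ Nat.card (Loop β ω) := by
  have hw : ∀ γ : Loop β ω, loopWeight N (fun _ => 0) γ = (N : ℝ) + 1 := by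
    intro γ
    simp [loopWeight]
  simp only [hw]
  rcases finite_or_infinite (Loop β ω) with hfin | hinf
  · have := Fintype.ofFinite (Loop β ω)
    rw [finprod_eq_prod_of_fintype, Finset.prod_const, Finset.card_univ, Nat.card_eq_fintype_card]
  -- The default values agree: `Nat.card` is 0, and `finprod` is 1 whether the constant is 1 or has
  -- infinite multiplicative support.
  · rw [Nat.card_eq_zero_of_infinite, pow_zero]
    rcases eq_or_ne ((N : ℝ) + 1) 1 with h1 | h1
    · exact finprod_eq_one_of_forall_eq_one fun _ => h1
    · refine finprod_of_infinite_mulSupport ?_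
      rw [Function.mulSupport_const h1]
      exact Set.infinite_univ

/-- The partition function is the integral of the product of the loop weights. -/
theorem integral_finprod_loopWeight [DecidableRel G.Adj] (N : ℕ) {u β : ℝ}
    (hu : u ∈ Set.Icc (0 : ℝ) 1) (hβ : 0 ≤ β) (h : V → ℝ) :
    Integrable (fun ω => ((∏ᶠ γ : Loop β ω, loopWeight N h γ : ℝ) : ℂ)) (rho G u β) ∧
      ∫ ω, ((∏ᶠ γ : Loop β ω, loopWeight N h γ : ℝ) : ℂ) ∂(rho G u β) =
        partitionFunction G N u β h := by
  classical
  have : Finite (Mark G) := Finite.of_injective (β := G.edgeSet × Bool)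
    (fun m => (m.edge, match m.kind with | Kind.cross => true | Kind.doubleBar => false)) (by
      rintro ⟨e, _ | _⟩ ⟨e', _ | _⟩ h <;> simp_all)
  set ν := markIntensity G u with hν
  set D : Op V N := Matrix.diagonal fun σ => (fieldEnergy N h σ : ℂ) with hD
  set B : Mark G → Op V N := markOp N with hB
  have hBm : StronglyMeasurable B := StronglyMeasurable.of_discrete
  obtain ⟨k, hk⟩ : ∃ k, ∀ m, ‖B m‖ ≤ k := by
    obtain ⟨k, hk⟩ := (Set.finite_range fun m => ‖B m‖).bddAbove
    exact ⟨k, fun m => hk ⟨m, rfl⟩⟩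
  have : CompleteSpace (Op V N) := FiniteDimensional.complete ℝ _
  obtain ⟨c, hc, hCb⟩ := exists_norm_interaction_le hk D β
  -- `X ↦ Tr(e^{βD} X)` is continuous and linear, so it passes through the Dyson sum and its
  -- integrals.
  set Φ : Op V N →L[ℝ] ℂ := LinearMap.toContinuousLinearMap
    ((Matrix.traceLinearMap (V → Fin (N + 1)) ℝ ℂ) ∘ₗ
      LinearMap.mulLeft ℝ (NormedSpace.exp (β • D))) with hΦ
  have hΦa : ∀ X, Φ X = (NormedSpace.exp (β • D) * X).trace := fun X => rfl
  have hexp : ∀ s : ℝ, NormedSpace.exp (s • D) =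
      Matrix.diagonal fun σ => ((Real.exp (s * fieldEnergy N h σ) : ℝ) : ℂ) :=
    exp_smul_diagonal _
  have hC : ∀ y : Event G, interaction D B y =
      (Matrix.diagonal fun σ => ((Real.exp (-y.2 * fieldEnergy N h σ) : ℝ) : ℂ)) *
        markOp N y.1 * Matrix.diagonal fun σ => ((Real.exp (y.2 * fieldEnergy N h σ) : ℝ) : ℂ) :=
    fun y => by rw [interaction, hexp, hexp]
  have hCm := stronglyMeasurable_orderedProd (stronglyMeasurable_interaction hBm D)
  have hPb : ∀ n, ∀ x ∈ orderedTuples (Mark G) n β,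
      ‖orderedProd (interaction D B) n x‖ ≤ c ^ n := fun n x hx =>
    norm_orderedProd_le hc hCb n x fun i => ⟨(hx.2 i).1.le, (hx.2 i).2.le⟩
  have hF : ∀ n, ∀ x ∈ orderedTuples (Mark G) n β,
      ((∏ᶠ γ : Loop β (toConfig n x), loopWeight N h γ : ℝ) : ℂ) =
        Φ (orderedProd (interaction D B) n x) := by
    intro n x hx
    rw [finprod_loopWeight hx hβ N h, hΦa, hexp, trace_exp_mul_orderedProd N h β hC n x]
  have hΦm : ∀ n, StronglyMeasurable fun x => Φ (orderedProd (interaction D B) n x) :=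
    fun n => Φ.continuous.comp_stronglyMeasurable (hCm n)
  have hΦb : ∀ n, ∀ x ∈ orderedTuples (Mark G) n β,
      ‖Φ (orderedProd (interaction D B) n x)‖ ≤ ‖Φ‖ * c ^ n := fun n x hx =>
    (Φ.le_opNorm _).trans (mul_le_mul_of_nonneg_left (hPb n x hx) (norm_nonneg _))
  obtain ⟨hint, hsum⟩ := integral_poissonLaw ν β
    (F := fun ω => ((∏ᶠ γ : Loop β ω, loopWeight N h γ : ℝ) : ℂ))
    hΦm hF hΦb
  rw [rho, intensity_eq]
  refine ⟨hint, hsum.unique ?_⟩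
  have hdyson := ((hasSum_dyson ν hBm hk D hβ).mapL Φ).const_smul
    (Real.exp (-(ν.prod (volume.restrict (Set.Icc 0 β))).real Set.univ))
  convert hdyson using 1
  · funext n
    congr 1
    refine Φ.integral_comp_comm ?_
    refine Integrable.of_bound (hCm n).aestronglyMeasurable (c ^ n) ?_
    exact (ae_restrict_mem (measurableSet_orderedTuples n β)).mono (hPb n)
  -- `e^{βD}` cancels the `e^{-βD}` of the Dyson formula, and the scalar `e^{-β|E|}` is absorbed
  -- into the exponential of `-βH`.
  · rw [hΦa, ← mul_assoc, exp_smul_mul_exp_neg_smul, one_mul, intensity_real_univ G hu hβ,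
      partitionFunction, neg_smul_hamiltonian G N hu]
    let _ : NormedAlgebra ℚ (Op V N) := NormedAlgebra.restrictScalars ℚ ℝ _
    rw [NormedSpace.exp_add_of_commute ((Commute.one_right _).smul_right _),
      ← Algebra.algebraMap_eq_smul_one, ← NormedSpace.algebraMap_exp_comm,
      Algebra.algebraMap_eq_smul_one, mul_smul_comm, mul_one, Matrix.trace_smul, Real.exp_eq_exp_ℝ]

end Representation

end RandomLoop

theorem theorem4p2 {V : Type*} [Fintype V] [DecidableEq V] (G : SimpleGraph V)
    [DecidableRel G.Adj] (N : ℕ) (u β : ℝ) (hu : u ∈ Set.Icc (0 : ℝ) 1) (hβ : 0 ≤ β)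
    (h : V → ℝ) :
    MeasureTheory.Integrable
        (fun ω => ∏ᶠ γ : RandomLoop.Loop β ω, RandomLoop.loopWeight N h γ)
        (RandomLoop.rho G u β) ∧
      RandomLoop.partitionFunction G N u β h =
        ((∫ ω, ∏ᶠ γ : RandomLoop.Loop β ω, RandomLoop.loopWeight N h γ
          ∂(RandomLoop.rho G u β) : ℝ) : ℂ) ∧
      RandomLoop.partitionFunction G N u β (fun _ => 0) =
        ((∫ ω, ((N : ℝ) + 1) ^ Nat.card (RandomLoop.Loop β ω)
          ∂(RandomLoop.rho G u β) : ℝ) : ℂ) := by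
  have key := RandomLoop.integral_finprod_loopWeight G N hu hβ
  refine ⟨(key h).1.re, ?_, ?_⟩
  · rw [← (key h).2]
    exact integral_ofReal
  · rw [← (key fun _ => 0).2]
    simp only [RandomLoop.finprod_loopWeight_zero]
    exact integral_ofReal
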